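/- Consider a random access machine whose input is a read-only array of $n\ge 1$ points $p_1,\dots,p_n\in\mathbb{R}^2$ (in arbitrary order; repeated points, equal coordinates and collinearities are allowed), whose work-space consists of words of $O(\log n)$ bits, and which has a write-only output. In one step it performs an arithmetic operation on or a comparison of words, an access to the work-space or to the input, an arithmetic operation $+,-,\times$ on reals while evaluating a polynomial expression in coordinates of input points, a test of the sign of such an expression, or the report of an input point to the output; real numbers are not stored in the work-space (points are stored as indices). There are one fixed program for this machine and a constant $C$ such that for every $n\ge 1$ and every input array the program halts, reports the vertices (extreme points) of the convex hull of $\{p_1,\dots,p_n\}$, each exactly once and in clockwise order along the boundary, uses at most $C\,n^{1/2}$ words of work-space, and takes at most $C\,n^{3/2+\varepsilon}$ steps for every real $\varepsilon$ with $\sqrt{\log\log n/\log n}<\varepsilon<1$. (Here $\log$ is the natural logarithm; for $n\le 2$ the lower bound on $\varepsilon$ is read as $0$.) -/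

import Mathlib

/-!
A random access machine for planar point sets, with a read-only input array of `n` points, a
work-space of words, and a write-only output.

* Input: an array `P` of `n` points with real coordinates. No instruction modifies it.
* Work-space: `k` registers and `m` arrays of `s` cells each. Every register and every cell holds
  one word, a natural number below the word bound `w`. Accessing a cell outside the arrays or
  storing a number that is not a word is a fault: the run has no continuation.
* Real numbers occur only inside tests, which decide the sign of an arithmetic expression in the
  coordinates of input points. They cannot be stored, so that no information can be packed into a
  single real cell; a point is stored as its index in the input array.
* Output: a list of points, extended at its end by the instruction `report`, and never read.
* Time: every operation, comparison, memory access, input access and report costs one step.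
-/

namespace PointRAM

/-- Word expressions over `k` registers. -/
inductive WExp (k : ℕ) : Type
  | lit (c : ℕ) : WExp k
  /-- the number of input points -/
  | len : WExp k
  | reg (r : Fin k) : WExp k
  | add (a b : WExp k) : WExp k
  /-- truncated subtraction -/
  | sub (a b : WExp k) : WExp k
  | mul (a b : WExp k) : WExp k
  /-- division rounded down -/
  | div (a b : WExp k) : WExp k

namespace WExp

variable {k : ℕ}

def eval (n : ℕ) (ρ : Fin k → ℕ) : WExp k → ℕ
  | lit c => c
  | len => n
  | reg r => ρ r
  | add a b => a.eval n ρ + b.eval n ρ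
  | sub a b => a.eval n ρ - b.eval n ρ
  | mul a b => a.eval n ρ * b.eval n ρ
  | div a b => a.eval n ρ / b.eval n ρ

def cost : WExp k → ℕ
  | lit _ => 1
  | len => 1
  | reg _ => 1
  | add a b => a.cost + b.cost + 1
  | sub a b => a.cost + b.cost + 1
  | mul a b => a.cost + b.cost + 1
  | div a b => a.cost + b.cost + 1

end WExp

/-- Reading the input array; a position outside the array reads as the origin. -/
noncomputable def readPoint {n : ℕ} (P : Fin n → ℝ × ℝ) (i : ℕ) : ℝ × ℝ :=
  if h : i < n then P ⟨i, h⟩ else 0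

/-- Real expressions in the coordinates of input points. -/
inductive RExp (k : ℕ) : Type
  | const (c : ℤ) : RExp k
  /-- first coordinate of the input point at position `e` -/
  | xCoord (e : WExp k) : RExp k
  /-- second coordinate of the input point at position `e` -/
  | yCoord (e : WExp k) : RExp k
  | add (a b : RExp k) : RExp k
  | sub (a b : RExp k) : RExp k
  | mul (a b : RExp k) : RExp k

namespace RExp

variable {k n : ℕ}

noncomputable def eval (P : Fin n → ℝ × ℝ) (ρ : Fin k → ℕ) : RExp k → ℝ
  | const c => (c : ℝ)
  | xCoord e => (readPoint P (e.eval n ρ)).1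
  | yCoord e => (readPoint P (e.eval n ρ)).2
  | add a b => a.eval P ρ + b.eval P ρ
  | sub a b => a.eval P ρ - b.eval P ρ
  | mul a b => a.eval P ρ * b.eval P ρ

def cost : RExp k → ℕ
  | const _ => 1
  | xCoord e => e.cost + 1
  | yCoord e => e.cost + 1
  | add a b => a.cost + b.cost + 1
  | sub a b => a.cost + b.cost + 1
  | mul a b => a.cost + b.cost + 1

end RExp

/-- Tests. -/
inductive Test (k : ℕ) : Type
  | lt (a b : WExp k) : Test k
  | eq (a b : WExp k) : Test k
  /-- the real number `a` is positive -/
  | pos (a : RExp k) : Test k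
  | not (t : Test k) : Test k
  | and (t u : Test k) : Test k
  | or (t u : Test k) : Test k

namespace Test

variable {k n : ℕ}

def Holds (P : Fin n → ℝ × ℝ) (ρ : Fin k → ℕ) : Test k → Prop
  | lt a b => a.eval n ρ < b.eval n ρ
  | eq a b => a.eval n ρ = b.eval n ρ
  | pos a => 0 < a.eval P ρ
  | not t => ¬ t.Holds P ρ
  | and t u => t.Holds P ρ ∧ u.Holds P ρ
  | or t u => t.Holds P ρ ∨ u.Holds P ρ

def cost : Test k → ℕ
  | lt a b => a.cost + b.cost + 1
  | eq a b => a.cost + b.cost + 1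
  | pos a => a.cost + 1
  | not t => t.cost + 1
  | and t u => t.cost + u.cost + 1
  | or t u => t.cost + u.cost + 1

end Test

/-- Programs with `k` registers and `m` work arrays. -/
inductive Prog (k m : ℕ) : Type
  | skip : Prog k m
  /-- `r := e` -/
  | assign (r : Fin k) (e : WExp k) : Prog k m
  /-- `r := a[i]` -/
  | load (r : Fin k) (a : Fin m) (i : WExp k) : Prog k m
  /-- `a[i] := e` -/
  | store (a : Fin m) (i e : WExp k) : Prog k m
  /-- append the input point at position `e` to the output -/
  | report (e : WExp k) : Prog k m
  | seq (p q : Prog k m) : Prog k m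
  | ite (t : Test k) (p q : Prog k m) : Prog k m
  /-- repeat `p` as long as `t` holds -/
  | loop (t : Test k) (p : Prog k m) : Prog k m

/-- Contents of the registers and of the work arrays, and the output written so far. -/
structure State (k m : ℕ) : Type where
  reg : Fin k → ℕ
  arr : Fin m → ℕ → ℕ
  out : List (ℝ × ℝ)

/-- The initial state: a work-space filled with zeros and an empty output. -/
def State.init (k m : ℕ) : State k m where
  reg := fun _ => 0
  arr := fun _ _ => 0
  out := []

/-- `Exec P s w p σ t τ`: on the input array `P`, with work arrays of `s` cells and with words below
`w`, the program `p` started in `σ` halts without a fault after `t` steps in `τ`. -/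
inductive Exec {k m n : ℕ} (P : Fin n → ℝ × ℝ) (s w : ℕ) :
    Prog k m → State k m → ℕ → State k m → Prop
  | skip (σ : State k m) : Exec P s w Prog.skip σ 1 σ
  | assign (σ : State k m) (r : Fin k) (e : WExp k) (hw : e.eval n σ.reg < w) :
      Exec P s w (Prog.assign r e) σ (e.cost + 1)
        { σ with reg := Function.update σ.reg r (e.eval n σ.reg) }
  | load (σ : State k m) (r : Fin k) (a : Fin m) (i : WExp k) (hi : i.eval n σ.reg < s) :
      Exec P s w (Prog.load r a i) σ (i.cost + 1)
        { σ with reg := Function.update σ.reg r (σ.arr a (i.eval n σ.reg)) }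
  | store (σ : State k m) (a : Fin m) (i e : WExp k) (hi : i.eval n σ.reg < s)
      (hw : e.eval n σ.reg < w) :
      Exec P s w (Prog.store a i e) σ (i.cost + e.cost + 1)
        { σ with
          arr := Function.update σ.arr a
            (Function.update (σ.arr a) (i.eval n σ.reg) (e.eval n σ.reg)) }
  | report (σ : State k m) (e : WExp k) :
      Exec P s w (Prog.report e) σ (e.cost + 1)
        { σ with out := σ.out ++ [readPoint P (e.eval n σ.reg)] }
  | seq {σ₁ σ₂ σ₃ : State k m} {p q : Prog k m} {t₁ t₂ : ℕ}
      (h₁ : Exec P s w p σ₁ t₁ σ₂) (h₂ : Exec P s w q σ₂ t₂ σ₃) :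
      Exec P s w (Prog.seq p q) σ₁ (t₁ + t₂) σ₃
  | ite_true {σ₁ σ₂ : State k m} {c : Test k} {p q : Prog k m} {t : ℕ}
      (hc : c.Holds P σ₁.reg) (h : Exec P s w p σ₁ t σ₂) :
      Exec P s w (Prog.ite c p q) σ₁ (c.cost + t) σ₂
  | ite_false {σ₁ σ₂ : State k m} {c : Test k} {p q : Prog k m} {t : ℕ}
      (hc : ¬ c.Holds P σ₁.reg) (h : Exec P s w q σ₁ t σ₂) :
      Exec P s w (Prog.ite c p q) σ₁ (c.cost + t) σ₂
  | loop_true {σ₁ σ₂ σ₃ : State k m} {c : Test k} {p : Prog k m} {t₁ t₂ : ℕ}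
      (hc : c.Holds P σ₁.reg) (h₁ : Exec P s w p σ₁ t₁ σ₂)
      (h₂ : Exec P s w (Prog.loop c p) σ₂ t₂ σ₃) :
      Exec P s w (Prog.loop c p) σ₁ (c.cost + t₁ + t₂) σ₃
  | loop_false {σ : State k m} {c : Test k} {p : Prog k m}
      (hc : ¬ c.Holds P σ.reg) :
      Exec P s w (Prog.loop c p) σ c.cost σ

end PointRAM

/-- Twice the signed area of the triangle `p q r`; negative iff `p, q, r` is a right turn. -/
def orientation2D (p q r : ℝ × ℝ) : ℝ :=
  (q.1 - p.1) * (r.2 - p.2) - (q.2 - p.2) * (r.1 - p.1)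

/-- `L` lists the vertices of the convex hull of `S`, each exactly once, in clockwise order along
the boundary: any three of them, taken in the order of the list, make a right turn. -/
structure IsConvexHullList (S : Set (ℝ × ℝ)) (L : List (ℝ × ℝ)) : Prop where
  nodup : L.Nodup
  mem_iff : ∀ p, p ∈ L ↔ p ∈ (convexHull ℝ S).extremePoints ℝ
  clockwise : L.Triplewise fun p q r => orientation2D p q r < 0

/-!
Sweep the points in lexicographic order, from left to right for the upper hull chain and from right
to left for the lower one. Cut the array into about `√n` blocks of about `√n` positions and
remember, for each block, its first position in sweep order after the current one. The next position
of the sweep is the first of the remembered ones, and only its block has to be searched again, so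
that the input is streamed in sorted order with `O(√n)` words and `O(√n)` steps per point.

The stream is processed in batches of about `√n` points. The stack of the monotone chain algorithm
is continued over a batch from the last known vertex; then all points still to come, in any order,
pop the top as long as they show it to lie below the hull. A top that survives them all is a hull
vertex, hence so is everything beneath it, and all but the top can be reported and forgotten. A
batch costs `O(n)` steps and there are about `√n` batches, so the total is `O(n ^ (3 / 2))` without
any `ε`.
-/

namespace PlanarHull

/-! ### Turns of monotone chains -/

theorem isOrderedModule_lex : IsOrderedModule ℝ (ℝ ×ₗ ℝ) :=
  IsOrderedModule.of_smul_nonneg fun a ha v hv => by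
    rw [Prod.Lex.le_iff] at hv ⊢
    rcases hv with hv | ⟨hv, hv'⟩
    · rcases ha.eq_or_lt with rfl | ha
      · simp
      · exact Or.inl (mul_pos ha hv)
    · exact Or.inr ⟨by simp [← hv], mul_nonneg ha hv'⟩

instance : IsStrictOrderedModule ℝ (ℝ ×ₗ ℝ) :=
  have := isOrderedModule_lex
  { PosSMulMono.toPosSMulStrictMono, SMulPosMono.toSMulPosStrictMono with }

/-- The position of a point in a sweep of the plane, from left to right for `d = 1` and from right
to left for `d = -1`, with ties broken by the second coordinate. Lexicographic comparison makes
the keys an ordered vector space. -/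
def lexKey (d : ℤˣ) (p : ℝ × ℝ) : ℝ ×ₗ ℝ := toLex (d • p)

theorem lexKey_injective (d : ℤˣ) : Function.Injective (lexKey d) :=
  toLex.injective.comp (MulAction.injective d)

theorem lexKey_neg (d : ℤˣ) (p : ℝ × ℝ) : lexKey (-d) p = -lexKey d p := by
  simp only [lexKey, Units.neg_smul, toLex_neg]

theorem lexKey_neg_lt_lexKey_neg {d : ℤˣ} {p q : ℝ × ℝ} :
    lexKey (-d) p < lexKey (-d) q ↔ lexKey d q < lexKey d p := by
  rw [lexKey_neg, lexKey_neg, neg_lt_neg_iff]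

/-- Twice the signed area of the triangle spanned by two vectors. -/
def cross (u v : ℝ ×ₗ ℝ) : ℝ := (ofLex u).1 * (ofLex v).2 - (ofLex u).2 * (ofLex v).1

theorem cross_smul_eq (u v w : ℝ ×ₗ ℝ) :
    cross u w • v = cross v w • u + cross u v • w := by
  apply ofLex.injective
  ext
  · simp [cross]; ring
  · simp [cross]; ring

theorem cross_neg_trans {u v w : ℝ ×ₗ ℝ} (hu : 0 < u) (hv : 0 < v) (hw : 0 < w)
    (huv : cross u v < 0) (hvw : cross v w < 0) : cross u w < 0 := by
  have hlt : cross u w • v < 0 := by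
    rw [cross_smul_eq]
    exact add_neg (smul_neg_of_neg_of_pos hvw hu) (smul_neg_of_neg_of_pos huv hw)
  by_contra! h
  exact (smul_nonneg h hv.le).not_gt hlt

theorem cross_nonneg_trans {u v w : ℝ ×ₗ ℝ} (hu : 0 < u) (hv : 0 < v) (hw : 0 < w)
    (huv : 0 ≤ cross u v) (hvw : 0 ≤ cross v w) : 0 ≤ cross u w := by
  have hle : 0 ≤ cross u w • v := by
    rw [cross_smul_eq]
    exact add_nonneg (smul_nonneg hvw hu.le) (smul_nonneg huv hw.le)
  by_contra! h
  exact (smul_neg_of_neg_of_pos h hv).not_ge hle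

theorem orientation2D_rotate (p q r : ℝ × ℝ) : orientation2D q r p = orientation2D p q r := by
  unfold orientation2D; ring

theorem orientation2D_swap (p q r : ℝ × ℝ) : orientation2D p r q = -orientation2D p q r := by
  unfold orientation2D; ring

theorem orientation2D_self_left (p q : ℝ × ℝ) : orientation2D p q p = 0 := by
  unfold orientation2D; ring

theorem orientation2D_self_right (p q : ℝ × ℝ) : orientation2D p q q = 0 := by
  unfold orientation2D; ring

theorem orientation2D_eq_cross (d : ℤˣ) (p q r : ℝ × ℝ) :
    orientation2D p q r = cross (lexKey d q - lexKey d p) (lexKey d r - lexKey d p) := by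
  rcases Int.units_eq_one_or d with rfl | rfl
  · simp [orientation2D, cross, lexKey]
  · simp [orientation2D, cross, lexKey]; ring

theorem turn_trans {d : ℤˣ} {a b c e : ℝ × ℝ} (hab : lexKey d a < lexKey d b)
    (hbc : lexKey d b < lexKey d c) (hce : lexKey d c < lexKey d e)
    (habc : orientation2D a b c < 0) (hbce : orientation2D b c e < 0) :
    orientation2D a b e < 0 ∧ orientation2D a c e < 0 := by
  have key := @cross_neg_trans _ _ _ (sub_pos.2 hab) (sub_pos.2 hbc) (sub_pos.2 hce)
  simp only [orientation2D_eq_cross d] at *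
  simp only [cross, ofLex_sub, Prod.fst_sub, Prod.snd_sub] at *
  have := key (by linarith) (by linarith)
  constructor <;> linarith

theorem orientation2D_neg_of_ends_nonpos {d : ℤˣ} {a b p q r : ℝ × ℝ}
    (har : lexKey d a < lexKey d r) (hrb : lexKey d r < lexKey d b)
    (hpq : lexKey d p < lexKey d q) (harb : 0 < orientation2D a r b) (ha : orientation2D p q a ≤ 0)
    (hb : orientation2D p q b ≤ 0) : orientation2D p q r < 0 := by
  by_contra! hr
  have key := @cross_nonneg_trans _ _ _ (sub_pos.2 hrb) (sub_pos.2 hpq) (sub_pos.2 har)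
  simp only [orientation2D_eq_cross d] at *
  simp only [cross, ofLex_sub, Prod.fst_sub, Prod.snd_sub] at *
  have := key (by linarith) (by linarith)
  linarith

theorem map_smul_sub_map_smul_eq_cross_smul (f : ℝ × ℝ →L[ℝ] ℝ) (v w : ℝ ×ₗ ℝ) :
    f (ofLex w) • v - f (ofLex v) • w = cross v w • toLex (f (0, 1), -f (1, 0)) := by
  have hf (z : ℝ × ℝ) : f z = f (1, 0) * z.1 + f (0, 1) * z.2 := by
    conv_lhs => rw [show z = z.1 • ((1, 0) : ℝ × ℝ) + z.2 • ((0, 1) : ℝ × ℝ) by ext <;> simp]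
    rw [map_add, map_smul, map_smul, smul_eq_mul, smul_eq_mul, mul_comm, mul_comm z.2]
  apply ofLex.injective
  rw [hf (ofLex v), hf (ofLex w)]
  ext
  · simp [cross]; ring
  · simp [cross]; ring

theorem not_mem_extremePoints_of_below_of_above {S : Set (ℝ × ℝ)} (hS : S.Finite)
    {a u b a' b' : ℝ × ℝ} (ha : a ∈ S) (hb : b ∈ S) (hau : lexKey 1 a < lexKey 1 u)
    (hub : lexKey 1 u < lexKey 1 b) (h : 0 ≤ orientation2D a u b) (ha' : a' ∈ S) (hb' : b' ∈ S)
    (hau' : lexKey (-1) a' < lexKey (-1) u) (hub' : lexKey (-1) u < lexKey (-1) b')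
    (h' : 0 ≤ orientation2D a' u b') : u ∉ (convexHull ℝ S).extremePoints ℝ := by
  intro hu
  have hu' : u ∉ convexHull ℝ (S \ {u}) := fun hmem =>
    ((convex_convexHull ℝ S).mem_extremePoints_iff_mem_sdiff_convexHull_sdiff.1 hu).2
      (convexHull_mono (Set.sdiff_subset_sdiff_left (subset_convexHull ℝ S)) hmem)
  have hclosed : IsClosed (convexHull ℝ (S \ {u})) :=
    ((hS.subset Set.sdiff_subset).isCompact_convexHull ℝ).isClosed
  obtain ⟨f, c, hf, hc⟩ := geometric_hahn_banach_closed_point (convex_convexHull ℝ _) hclosed hu'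
  rw [lexKey_neg_lt_lexKey_neg] at hau' hub'
  have hneg : ∀ z ∈ S, lexKey 1 z ≠ lexKey 1 u → f (ofLex (lexKey 1 z - lexKey 1 u)) < 0 := by
    intro z hz hzu
    have : f z < f u := (hf z (subset_convexHull ℝ _ ⟨hz, by rintro rfl; exact hzu rfl⟩)).trans hc
    simpa [lexKey] using this
  have hcross (p q : ℝ × ℝ) :
      cross (lexKey 1 p - lexKey 1 u) (lexKey 1 q - lexKey 1 u) = -orientation2D p u q := by
    rw [← orientation2D_eq_cross, orientation2D_swap, orientation2D_rotate]
  -- The two segments force opposite signs on the functional `f` turned by a right angle.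
  set g : ℝ ×ₗ ℝ := toLex (f (0, 1), -f (1, 0))
  have hlt : g < 0 := by
    have hpos : 0 < -orientation2D a u b • g := by
      rw [← hcross, ← map_smul_sub_map_smul_eq_cross_smul]
      exact sub_pos.2 ((smul_neg_of_neg_of_pos (hneg a ha hau.ne) (sub_pos.2 hub)).trans
        (smul_pos_of_neg_of_neg (hneg b hb hub.ne') (sub_neg.2 hau)))
    by_contra! hg
    exact (smul_nonneg h hg).not_gt (by simpa only [neg_smul, neg_pos] using hpos)
  have hgt : 0 < g := by
    have hneg' : -orientation2D a' u b' • g < 0 := by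
      rw [← hcross, ← map_smul_sub_map_smul_eq_cross_smul]
      exact sub_neg.2 ((smul_neg_of_neg_of_pos (hneg b' hb' hub'.ne) (sub_pos.2 hau')).trans
        (smul_pos_of_neg_of_neg (hneg a' ha' hau'.ne') (sub_neg.2 hub')))
    by_contra! hg
    exact (smul_nonpos_of_nonneg_of_nonpos h' hg).not_gt
      (by simpa only [neg_smul, neg_lt_zero] using hneg')
  exact hlt.asymm hgt

/-! ### Monotone chains and the convex hull -/

/-- Any three points of the list, taken in order, make a right turn. -/
def IsClockwise (L : List (ℝ × ℝ)) : Prop := L.Triplewise fun p q r => orientation2D p q r < 0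

theorem isClockwise_cons {p : ℝ × ℝ} {L : List (ℝ × ℝ)} :
    IsClockwise (p :: L) ↔ L.Pairwise (fun q r => orientation2D p q r < 0) ∧ IsClockwise L :=
  List.triplewise_cons

theorem isClockwise_append {X Y : List (ℝ × ℝ)} :
    IsClockwise (X ++ Y) ↔ IsClockwise X ∧ IsClockwise Y ∧
      (∀ p ∈ X, Y.Pairwise fun q r => orientation2D p q r < 0) ∧
      ∀ r ∈ Y, X.Pairwise fun p q => orientation2D p q r < 0 := by
  rw [IsClockwise, List.triplewise_append]
  rfl

theorem IsClockwise.rotate {X Y : List (ℝ × ℝ)} (h : IsClockwise (X ++ Y)) :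
    IsClockwise (Y ++ X) := by
  obtain ⟨hX, hY, hXYY, hXXY⟩ := isClockwise_append.1 h
  refine isClockwise_append.2 ⟨hY, hX, fun r hr => ?_, fun p hp => ?_⟩
  · exact (hXXY r hr).imp fun h => by rwa [← orientation2D_rotate]
  · exact (hXYY p hp).imp fun h => by rwa [orientation2D_rotate]

theorem convex_setOf_orientation2D_nonneg (p q : ℝ × ℝ) :
    Convex ℝ {z | 0 ≤ orientation2D p q z} := by
  rintro x hx y hy a b ha hb hab
  have hcomb : orientation2D p q (a • x + b • y) =
      a * orientation2D p q x + b * orientation2D p q y := by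
    obtain rfl : b = 1 - a := by linarith
    simp only [orientation2D, Prod.fst_add, Prod.snd_add, Prod.smul_fst, Prod.smul_snd,
      smul_eq_mul]
    ring
  exact (add_nonneg (mul_nonneg ha hx) (mul_nonneg hb hy)).trans_eq hcomb.symm

/-- The line through the two neighbours of `u` in a clockwise polygon separates `u` from the other
vertices. -/
theorem IsClockwise.head_not_mem_convexHull {u : ℝ × ℝ} {R : List (ℝ × ℝ)}
    (h : IsClockwise (u :: R)) (hu : u ∉ R) : u ∉ convexHull ℝ {z | z ∈ R} := by
  obtain ⟨hpair, hR⟩ := isClockwise_cons.1 h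
  rcases R with _ | ⟨q, R⟩
  · simp
  rcases List.eq_nil_or_concat R with rfl | ⟨R, p, rfl⟩
  · simpa using hu
  rw [List.concat_eq_append] at *
  have hsub : {z | z ∈ q :: (R ++ [p])} ⊆ {z | 0 ≤ orientation2D q p z} := by
    intro z hz
    simp only [List.mem_cons, List.mem_append, List.not_mem_nil, or_false,
      Set.mem_ofPred_eq] at hz ⊢
    rcases hz with rfl | hz | rfl
    · exact (orientation2D_self_left _ _).ge
    · have := (List.pairwise_append.1 (isClockwise_cons.1 hR).1).2.2 z hz p (by simp)
      rw [orientation2D_swap]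
      exact (neg_pos.2 this).le
    · exact (orientation2D_self_right _ _).ge
  intro hmem
  have hnonneg : 0 ≤ orientation2D q p u :=
    convexHull_min hsub (convex_setOf_orientation2D_nonneg q p) hmem
  rw [orientation2D_rotate] at hnonneg
  exact hnonneg.not_gt ((List.pairwise_cons.1 hpair).1 p (by simp))

theorem isConvexHullList_of_forall_mem {S : Set (ℝ × ℝ)} (hS : S.Finite) {L : List (ℝ × ℝ)}
    (hLS : ∀ p ∈ L, p ∈ S) (hnodup : L.Nodup) (hturn : IsClockwise L)
    (hext : ∀ p ∈ (convexHull ℝ S).extremePoints ℝ, p ∈ L) : IsConvexHullList S L := by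
  refine ⟨hnodup, fun p => ⟨fun hp => ?_, hext p⟩, hturn⟩
  by_contra hnot
  obtain ⟨X, Y, rfl⟩ := List.append_of_mem hp
  have hpYX : p ∉ Y ++ X := by
    have := (List.nodup_cons.1 (List.nodup_middle.1 hnodup)).1
    simpa only [List.mem_append, or_comm] using this
  refine (show IsClockwise (p :: (Y ++ X)) from hturn.rotate).head_not_mem_convexHull hpYX ?_
  have hsub : (convexHull ℝ S).extremePoints ℝ ⊆ {z | z ∈ Y ++ X} := by
    intro z hz
    have hzp : z ≠ p := fun e => hnot (e ▸ hz)
    have := hext z hz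
    simp only [List.mem_append, List.mem_cons, Set.mem_ofPred_eq] at this ⊢
    tauto
  have hKM := closure_convexHull_extremePoints (hS.isCompact_convexHull ℝ) (convex_convexHull ℝ S)
  have hfin : ((convexHull ℝ S).extremePoints ℝ).Finite :=
    hS.subset extremePoints_convexHull_subset
  rw [(hfin.isCompact_convexHull ℝ).isClosed.closure_eq] at hKM
  exact convexHull_mono hsub (hKM.ge (subset_convexHull ℝ S (hLS p hp)))

/-- A list of points, latest first, that is monotone in direction `d` and turns right at each of
its inner points. -/
def TurnChain (d : ℤˣ) : List (ℝ × ℝ) → Prop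
  | u :: a :: l =>
    lexKey d a < lexKey d u ∧ (∀ b ∈ l.head?, orientation2D b a u < 0) ∧ TurnChain d (a :: l)
  | _ => True

theorem TurnChain.tail {d : ℤˣ} {u : ℝ × ℝ} {l : List (ℝ × ℝ)} (h : TurnChain d (u :: l)) :
    TurnChain d l := by
  cases l with
  | nil => trivial
  | cons a l => exact h.2.2

theorem TurnChain.pairwise {d : ℤˣ} {l : List (ℝ × ℝ)} (h : TurnChain d l) :
    l.Pairwise fun u a => lexKey d a < lexKey d u := by
  induction l with
  | nil => exact List.Pairwise.nil
  | cons u l ih =>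
    refine List.pairwise_cons.2 ⟨?_, ih h.tail⟩
    rcases l with _ | ⟨a, l⟩
    · exact List.forall_mem_nil _
    · exact List.forall_mem_cons.2
        ⟨h.1, fun x hx => ((List.pairwise_cons.1 (ih h.tail)).1 x hx).trans h.1⟩

theorem TurnChain.orientation2D_neg {d : ℤˣ} {u a : ℝ × ℝ} {l : List (ℝ × ℝ)}
    (h : TurnChain d (u :: a :: l))
    (hal : (a :: l).Triplewise fun u a b => orientation2D b a u < 0) :
    ∀ y ∈ l, orientation2D y a u < 0 := by
  rcases l with _ | ⟨b, l⟩
  · exact List.forall_mem_nil _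
  have hb : orientation2D b a u < 0 := h.2.1 b rfl
  refine List.forall_mem_cons.2 ⟨hb, fun y hy => ?_⟩
  have hyb : lexKey d y < lexKey d b := (List.pairwise_cons.1 h.tail.tail.pairwise).1 y hy
  have hyba : orientation2D y b a < 0 :=
    (List.pairwise_cons.1 (List.triplewise_cons.1 hal).1).1 y hy
  exact (turn_trans hyb h.tail.1 h.1 hyba hb).2

theorem TurnChain.triplewise {d : ℤˣ} {l : List (ℝ × ℝ)} (h : TurnChain d l) :
    l.Triplewise fun u a b => orientation2D b a u < 0 := by
  induction l with
  | nil => exact List.Triplewise.nil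
  | cons u l ih =>
    refine List.triplewise_cons.2 ⟨?_, ih h.tail⟩
    rcases l with _ | ⟨a, l⟩
    · exact List.Pairwise.nil
    have hturn := h.orientation2D_neg (ih h.tail)
    have hal := List.pairwise_cons.1 h.tail.pairwise
    refine List.pairwise_cons.2 ⟨hturn, List.Pairwise.imp_of_mem ?_
      (hal.2.and (List.triplewise_cons.1 (ih h.tail)).1)⟩
    rintro x y hx - ⟨hyx, hyxa⟩
    exact (turn_trans hyx (hal.1 x hx) h.1 hyxa (hturn x hx)).1

/-- The point `p` lies weakly to the right of a segment between points of `S` that straddles it in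
direction `d`; it may still be a vertex of the hull, on the side of the opposite direction. -/
def RightOfSegment (d : ℤˣ) (S : Set (ℝ × ℝ)) (p : ℝ × ℝ) : Prop :=
  ∃ a ∈ S, ∃ b ∈ S, lexKey d a < lexKey d p ∧ lexKey d p < lexKey d b ∧ 0 ≤ orientation2D a p b

/-- `O` is a chain of points of `S` that is monotone in direction `d`, turns right, and passes
weakly to the left of all other points of `S`. For `d = 1` it is the upper hull from its first to
its last point, for `d = -1` the lower hull. -/
structure IsHullChain (d : ℤˣ) (S : Set (ℝ × ℝ)) (O : List (ℝ × ℝ)) : Prop where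
  subset : ∀ p ∈ O, p ∈ S
  sorted : O.Pairwise fun p q => lexKey d p < lexKey d q
  turn : IsClockwise O
  cover : ∀ p ∈ S, p ∈ O ∨ RightOfSegment d S p

theorem nodup_of_sorted {d : ℤˣ} {O : List (ℝ × ℝ)}
    (h : O.Pairwise fun p q => lexKey d p < lexKey d q) : O.Nodup :=
  h.imp fun hlt => by rintro rfl; exact hlt.false

theorem IsHullChain.exists_eq_cons_append {d : ℤˣ} {S : Set (ℝ × ℝ)} {O : List (ℝ × ℝ)}
    (hO : IsHullChain d S O) {lo hi : ℝ × ℝ} (hloS : lo ∈ S) (hhiS : hi ∈ S)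
    (hlo : ∀ p ∈ S, lexKey d lo ≤ lexKey d p) (hhi : ∀ p ∈ S, lexKey d p ≤ lexKey d hi)
    (hne : lo ≠ hi) : ∃ M, O = lo :: (M ++ [hi]) := by
  have hloO : lo ∈ O := (hO.cover lo hloS).resolve_right
    fun ⟨a, ha, _, _, h, _⟩ => (hlo a ha).not_gt h
  have hhiO : hi ∈ O := (hO.cover hi hhiS).resolve_right
    fun ⟨_, _, b, hb, _, h, _⟩ => (hhi b hb).not_gt h
  obtain ⟨X, Y, rfl⟩ := List.append_of_mem hloO
  obtain rfl : X = [] := List.eq_nil_iff_forall_not_mem.2 fun x hx =>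
    (hlo x (hO.subset x (by simp [hx]))).not_gt
      ((List.pairwise_append.1 hO.sorted).2.2 x hx lo (by simp))
  have hhiY : hi ∈ Y := by simpa [hne.symm] using hhiO
  obtain ⟨Z, W, rfl⟩ := List.append_of_mem hhiY
  obtain rfl : W = [] := List.eq_nil_iff_forall_not_mem.2 fun x hx =>
    (hhi x (hO.subset x (by simp [hx]))).not_gt
      ((List.pairwise_cons.1 (List.pairwise_append.1
        (List.pairwise_cons.1 hO.sorted).2).2.1).1 x hx)
  exact ⟨Z, rfl⟩

theorem orientation2D_pos_of_mem_opposite {d : ℤˣ} {T : Set (ℝ × ℝ)} {M' : List (ℝ × ℝ)}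
    {lo hi : ℝ × ℝ} (hD : IsHullChain (-d) T (hi :: (M' ++ [lo]))) {r : ℝ × ℝ} (hr : r ∈ M') :
    lexKey d lo < lexKey d r ∧ lexKey d r < lexKey d hi ∧ 0 < orientation2D lo r hi := by
  have hsort := List.pairwise_cons.1 hD.sorted
  have hturn := (List.pairwise_append.1 (isClockwise_cons.1 hD.turn).1).2.2 r hr lo (by simp)
  refine ⟨lexKey_neg_lt_lexKey_neg.1 ((List.pairwise_append.1 hsort.2).2.2 r hr lo (by simp)),
    lexKey_neg_lt_lexKey_neg.1 (hsort.1 r (by simp [hr])), ?_⟩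
  rw [orientation2D_swap, orientation2D_rotate, orientation2D_rotate]
  exact neg_pos.2 hturn

theorem turn_of_mem_opposite {d : ℤˣ} {S T : Set (ℝ × ℝ)} {M M' : List (ℝ × ℝ)}
    {lo hi : ℝ × ℝ} (hO : IsHullChain d S (lo :: (M ++ [hi])))
    (hD : IsHullChain (-d) T (hi :: (M' ++ [lo]))) {r : ℝ × ℝ} (hr : r ∈ hi :: M') :
    (lo :: M).Pairwise fun p q => orientation2D p q r < 0 := by
  have hsort : (lo :: M).Pairwise fun p q => lexKey d p < lexKey d q :=
    (List.pairwise_append (l₁ := lo :: M).1 hO.sorted).1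
  obtain ⟨hM, -, -, hhi⟩ := isClockwise_append (X := lo :: M).1 hO.turn
  rcases List.mem_cons.1 hr with rfl | hr
  · exact hhi r (by simp)
  obtain ⟨hlor, hrhi, hpos⟩ := orientation2D_pos_of_mem_opposite hD hr
  have hlo : (lo :: M).Pairwise fun p q => orientation2D p q lo ≤ 0 :=
    List.pairwise_cons.2 ⟨fun q _ => (orientation2D_self_left lo q).le,
      (isClockwise_cons.1 hM).1.imp fun h => by rw [orientation2D_rotate]; exact h.le⟩
  refine List.Pairwise.imp ?_ ((hsort.and hlo).and (hhi hi (by simp)))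
  rintro p q ⟨⟨hpq, hpqlo⟩, hpqhi⟩
  exact orientation2D_neg_of_ends_nonpos hlor hrhi hpq hpos hpqlo hpqhi.le

theorem disjoint_of_opposite {d : ℤˣ} {S T : Set (ℝ × ℝ)} {M M' : List (ℝ × ℝ)}
    {lo hi : ℝ × ℝ} (hO : IsHullChain d S (lo :: (M ++ [hi])))
    (hD : IsHullChain (-d) T (hi :: (M' ++ [lo]))) : (lo :: M).Disjoint (hi :: M') := by
  intro p hp hp'
  have hphi : lexKey d p < lexKey d hi :=
    (List.pairwise_append (l₁ := lo :: M).1 hO.sorted).2.2 p hp hi (by simp)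
  have hpM' : p ∈ M' := (List.mem_cons.1 hp').resolve_left (by rintro rfl; exact hphi.false)
  obtain ⟨hlop, -, hpos⟩ := orientation2D_pos_of_mem_opposite hD hpM'
  have hpM : p ∈ M := (List.mem_cons.1 hp).resolve_left (by rintro rfl; exact hlop.false)
  exact hpos.asymm ((List.pairwise_append.1 (isClockwise_cons.1 hO.turn).1).2.2 p hpM hi (by simp))

theorem isConvexHullList_of_chains {S : Set (ℝ × ℝ)} (hS : S.Finite) (hnt : S.Nontrivial)
    {O D : List (ℝ × ℝ)} (hO : IsHullChain 1 S O) (hD : IsHullChain (-1) S D) :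
    IsConvexHullList S (O.dropLast ++ D.dropLast) := by
  obtain ⟨lo, hloS, hlo⟩ := S.exists_min_image (lexKey 1) hS hnt.nonempty
  obtain ⟨hi, hhiS, hhi⟩ := S.exists_max_image (lexKey 1) hS hnt.nonempty
  have hne : lo ≠ hi := by
    rintro rfl
    exact hnt.not_subsingleton fun p hp q hq => lexKey_injective 1 <|
      ((hhi p hp).antisymm (hlo p hp)).trans ((hhi q hq).antisymm (hlo q hq)).symm
  have hneg {p q : ℝ × ℝ} (h : lexKey 1 p ≤ lexKey 1 q) : lexKey (-1) q ≤ lexKey (-1) p := by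
    rw [lexKey_neg, lexKey_neg]; exact neg_le_neg h
  obtain ⟨M, rfl⟩ := hO.exists_eq_cons_append hloS hhiS hlo hhi hne
  obtain ⟨M', rfl⟩ := hD.exists_eq_cons_append hhiS hloS (fun p hp => hneg (hhi p hp))
    (fun p hp => hneg (hlo p hp)) hne.symm
  have hO' : IsHullChain (-(-1)) S (lo :: (M ++ [hi])) := by rwa [neg_neg]
  rw [← List.cons_append, ← List.cons_append, List.dropLast_concat, List.dropLast_concat]
  refine isConvexHullList_of_forall_mem hS ?_ ?_ ?_ ?_
  · rintro p hp
    rcases List.mem_append.1 hp with hp | hp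
    · exact hO.subset p (List.mem_append_left [hi] hp)
    · exact hD.subset p (List.mem_append_left [lo] hp)
  · exact ((nodup_of_sorted hO.sorted).of_append_left (l₁ := lo :: M)).append
      ((nodup_of_sorted hD.sorted).of_append_left (l₁ := hi :: M')) (disjoint_of_opposite hO hD)
  · refine isClockwise_append.2 ⟨(isClockwise_append (X := lo :: M).1 hO.turn).1,
      (isClockwise_append (X := hi :: M').1 hD.turn).1, fun p hp => ?_,
      fun r hr => turn_of_mem_opposite hO hD hr⟩
    exact (turn_of_mem_opposite hD hO' hp).imp fun h => by rwa [← orientation2D_rotate]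
  · intro p hp
    have hpS := extremePoints_convexHull_subset hp
    by_contra hnot
    simp only [List.mem_append, List.mem_cons, not_or] at hnot
    obtain ⟨⟨hplo, hpM⟩, hphi, hpM'⟩ := hnot
    obtain ⟨a, ha, b, hb, hap, hpb, hapb⟩ :=
      (hO.cover p hpS).resolve_left (by simp [hplo, hpM, hphi])
    obtain ⟨a', ha', b', hb', hap', hpb', hapb'⟩ :=
      (hD.cover p hpS).resolve_left (by simp [hplo, hpM', hphi])
    exact not_mem_extremePoints_of_below_of_above hS ha hb hap hpb hapb ha' hb' hap' hpb' hapb' hp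

theorem isConvexHullList_singleton (p : ℝ × ℝ) : IsConvexHullList {p} [p] :=
  ⟨by simp, by simp, by simp⟩

theorem IsHullChain.dropLast_eq_nil {d : ℤˣ} {p : ℝ × ℝ} {O : List (ℝ × ℝ)}
    (h : IsHullChain d {p} O) : O.dropLast = [] := by
  rcases O with _ | ⟨a, _ | ⟨b, O⟩⟩
  · rfl
  · rfl
  · obtain rfl : a = p := h.subset a (by simp)
    obtain rfl : b = a := h.subset b (by simp)
    exact absurd ((List.pairwise_cons.1 h.sorted).1 b (by simp)) (lt_irrefl _)

end PlanarHull

/-! ### Total correctness with running times -/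

namespace PointRAM

section Calculus

variable {k m n : ℕ} {P : Fin n → ℝ × ℝ} {s w : ℕ} {σ : State k m} {Q : ℕ → State k m → Prop}

/-- The weakest precondition: the program `p` started in `σ` halts without a fault after some
number `t` of steps in some state `τ` such that `Q t τ`. -/
def WP (P : Fin n → ℝ × ℝ) (s w : ℕ) (p : Prog k m) (σ : State k m)
    (Q : ℕ → State k m → Prop) : Prop :=
  ∃ t τ, Exec P s w p σ t τ ∧ Q t τ

theorem WP.mono {p : Prog k m} {Q' : ℕ → State k m → Prop} (h : WP P s w p σ Q)
    (hQ : ∀ t τ, Q t τ → Q' t τ) : WP P s w p σ Q' := by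
  obtain ⟨t, τ, hexec, hτ⟩ := h
  exact ⟨t, τ, hexec, hQ t τ hτ⟩

theorem wp_skip : WP P s w Prog.skip σ Q ↔ Q 1 σ := by
  constructor
  · rintro ⟨_, _, ⟨⟩, h⟩
    exact h
  · exact fun h => ⟨_, _, Exec.skip σ, h⟩

theorem wp_assign {r : Fin k} {e : WExp k} :
    WP P s w (Prog.assign r e) σ Q ↔ e.eval n σ.reg < w ∧
      Q (e.cost + 1) { σ with reg := Function.update σ.reg r (e.eval n σ.reg) } := by
  constructor
  · rintro ⟨_, _, ⟨⟩, h⟩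
    exact ⟨by assumption, h⟩
  · exact fun h => ⟨_, _, Exec.assign σ r e h.1, h.2⟩

theorem wp_load {r : Fin k} {a : Fin m} {i : WExp k} :
    WP P s w (Prog.load r a i) σ Q ↔ i.eval n σ.reg < s ∧
      Q (i.cost + 1) { σ with reg := Function.update σ.reg r (σ.arr a (i.eval n σ.reg)) } := by
  constructor
  · rintro ⟨_, _, ⟨⟩, h⟩
    exact ⟨by assumption, h⟩
  · exact fun h => ⟨_, _, Exec.load σ r a i h.1, h.2⟩

theorem wp_store {a : Fin m} {i e : WExp k} :
    WP P s w (Prog.store a i e) σ Q ↔ i.eval n σ.reg < s ∧ e.eval n σ.reg < w ∧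
      Q (i.cost + e.cost + 1) { σ with
        arr := Function.update σ.arr a
          (Function.update (σ.arr a) (i.eval n σ.reg) (e.eval n σ.reg)) } := by
  constructor
  · rintro ⟨_, _, ⟨⟩, h⟩
    exact ⟨by assumption, by assumption, h⟩
  · exact fun h => ⟨_, _, Exec.store σ a i e h.1 h.2.1, h.2.2⟩

theorem wp_report {e : WExp k} :
    WP P s w (Prog.report e) σ Q ↔
      Q (e.cost + 1) { σ with out := σ.out ++ [readPoint P (e.eval n σ.reg)] } := by
  constructor
  · rintro ⟨_, _, ⟨⟩, h⟩
    exact h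
  · exact fun h => ⟨_, _, Exec.report σ e, h⟩

theorem wp_seq {p q : Prog k m} :
    WP P s w (Prog.seq p q) σ Q ↔
      WP P s w p σ fun t₁ τ => WP P s w q τ fun t₂ τ' => Q (t₁ + t₂) τ' := by
  constructor
  · rintro ⟨_, _, hexec, h⟩
    cases hexec with
    | seq h₁ h₂ => exact ⟨_, _, h₁, _, _, h₂, h⟩
  · rintro ⟨_, _, h₁, _, _, h₂, h⟩
    exact ⟨_, _, Exec.seq h₁ h₂, h⟩

theorem wp_ite {c : Test k} {p q : Prog k m} :
    WP P s w (Prog.ite c p q) σ Q ↔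
      (c.Holds P σ.reg → WP P s w p σ fun t τ => Q (c.cost + t) τ) ∧
      (¬ c.Holds P σ.reg → WP P s w q σ fun t τ => Q (c.cost + t) τ) := by
  constructor
  · rintro ⟨_, _, hexec, h⟩
    cases hexec with
    | ite_true hc hp => exact ⟨fun _ => ⟨_, _, hp, h⟩, fun hc' => absurd hc hc'⟩
    | ite_false hc hq => exact ⟨fun hc' => absurd hc' hc, fun _ => ⟨_, _, hq, h⟩⟩
  · rintro ⟨htrue, hfalse⟩
    by_cases hc : c.Holds P σ.reg
    · obtain ⟨_, _, hp, h⟩ := htrue hc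
      exact ⟨_, _, Exec.ite_true hc hp, h⟩
    · obtain ⟨_, _, hq, h⟩ := hfalse hc
      exact ⟨_, _, Exec.ite_false hc hq, h⟩

theorem Test.cost_pos (c : Test k) : 0 < c.cost := by
  cases c <;> simp [Test.cost]

/-- The potential `μ` pays for every iteration. -/
theorem WP.loop {c : Test k} {p : Prog k m} (I : State k m → Prop) (μ : State k m → ℕ)
    (hbody : ∀ σ, I σ → c.Holds P σ.reg →
      WP P s w p σ fun t τ => I τ ∧ c.cost + t + μ τ ≤ μ σ)
    (hI : I σ) :
    WP P s w (Prog.loop c p) σ fun t τ =>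
      I τ ∧ ¬ c.Holds P τ.reg ∧ t + μ τ ≤ μ σ + c.cost := by
  induction hN : μ σ using Nat.strong_induction_on generalizing σ with
  | _ N ih =>
    by_cases hc : c.Holds P σ.reg
    · obtain ⟨t, τ, hexec, hI', hμ⟩ := hbody σ hI hc
      have hpos := c.cost_pos
      obtain ⟨t', τ', hexec', hI'', hc', hμ'⟩ := ih (μ τ) (by omega) hI' rfl
      exact ⟨_, _, Exec.loop_true hc hexec hexec', hI'', hc', by omega⟩
    · exact ⟨_, _, Exec.loop_false hc, hI, hc, by omega⟩

/-- The state `τ` differs from `σ` at most in the registers `R`. -/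
structure AgreeOff (R : Finset (Fin k)) (σ τ : State k m) : Prop where
  arr : τ.arr = σ.arr
  out : τ.out = σ.out
  reg : ∀ r ∉ R, τ.reg r = σ.reg r

theorem AgreeOff.refl (R : Finset (Fin k)) (σ : State k m) : AgreeOff R σ σ :=
  ⟨rfl, rfl, fun _ _ => rfl⟩

theorem AgreeOff.mono {R R' : Finset (Fin k)} {σ τ : State k m} (h : AgreeOff R σ τ)
    (hR : R ⊆ R') : AgreeOff R' σ τ :=
  ⟨h.arr, h.out, fun r hr => h.reg r (Finset.notMem_mono hR hr)⟩

theorem AgreeOff.trans {R : Finset (Fin k)} {σ₁ σ₂ σ₃ : State k m} (h : AgreeOff R σ₁ σ₂)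
    (h' : AgreeOff R σ₂ σ₃) : AgreeOff R σ₁ σ₃ :=
  ⟨h'.arr.trans h.arr, h'.out.trans h.out, fun r hr => (h'.reg r hr).trans (h.reg r hr)⟩

theorem AgreeOff.assign {R : Finset (Fin k)} {σ τ : State k m} (h : AgreeOff R σ τ) {r : Fin k}
    (hr : r ∈ R) (v : ℕ) : AgreeOff R σ { τ with reg := Function.update τ.reg r v } :=
  ⟨h.arr, h.out, fun r' hr' =>
    (Function.update_of_ne (ne_of_mem_of_not_mem hr hr').symm v τ.reg).trans (h.reg r' hr')⟩

end Calculus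

/-! ### Comparisons and turns of input points -/

open PlanarHull

section Tests

variable {k n : ℕ} {P : Fin n → ℝ × ℝ} {d : ℤˣ} {ρ : Fin k → ℕ} {a b c : WExp k}

theorem readPoint_of_lt {i : ℕ} (hi : i < n) : readPoint P i = P ⟨i, hi⟩ := dif_pos hi

theorem readPoint_mem_range {i : ℕ} (hi : i < n) : readPoint P i ∈ Set.range P :=
  readPoint_of_lt hi ▸ Set.mem_range_self _

/-- The key by which the input positions are sorted in a sweep of direction `d`. Ties between equal
points are broken by the position, so that the keys of different positions differ; the position
`n`, which stands for the end of the sorted stream, comes last. -/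
noncomputable def sortKey (P : Fin n → ℝ × ℝ) (d : ℤˣ) (i : ℕ) : WithTop ((ℝ ×ₗ ℝ) ×ₗ ℕ) :=
  if i < n then ↑(toLex (lexKey d (readPoint P i), i)) else ⊤

/-- The test that `a` precedes `b` in a sweep of direction `d`. -/
def dirTest (d : ℤˣ) (a b : WExp k) : Test k :=
  .or (.pos (.mul (.const d) (.sub (.xCoord b) (.xCoord a))))
    (.and (.not (.pos (.mul (.const d) (.sub (.xCoord a) (.xCoord b)))))
      (.pos (.mul (.const d) (.sub (.yCoord b) (.yCoord a)))))

/-- The comparison of sort keys. -/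
def keyTest (d : ℤˣ) (a b : WExp k) : Test k :=
  .and (.lt a .len)
    (.or (.not (.lt b .len)) (.or (dirTest d a b) (.and (.not (dirTest d b a)) (.lt a b))))

/-- The test that `a, b, c` make a right turn. -/
def turnTest (a b c : WExp k) : Test k :=
  .pos (.sub (.mul (.sub (.yCoord b) (.yCoord a)) (.sub (.xCoord c) (.xCoord a)))
    (.mul (.sub (.xCoord b) (.xCoord a)) (.sub (.yCoord c) (.yCoord a))))

theorem holds_dirTest : (dirTest d a b).Holds P ρ ↔
    lexKey d (readPoint P (a.eval n ρ)) < lexKey d (readPoint P (b.eval n ρ)) := by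
  rcases Int.units_eq_one_or d with rfl | rfl <;>
    simp only [dirTest, Test.Holds, RExp.eval, lexKey, Prod.Lex.toLex_lt_toLex, Units.val_one,
      Units.val_neg, Int.cast_one, Int.cast_neg, one_smul, Units.neg_smul, Prod.fst_neg,
      Prod.snd_neg] <;>
    grind

theorem holds_keyTest :
    (keyTest d a b).Holds P ρ ↔ sortKey P d (a.eval n ρ) < sortKey P d (b.eval n ρ) := by
  simp only [keyTest, Test.Holds, WExp.eval, holds_dirTest, sortKey]
  by_cases ha : a.eval n ρ < n
  · by_cases hb : b.eval n ρ < n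
    · simp only [ha, hb, if_true, WithTop.coe_lt_coe, Prod.Lex.toLex_lt_toLex]
      grind
    · simp [ha, hb]
  · simp [ha]

theorem holds_turnTest :
    (turnTest a b c).Holds P ρ ↔ orientation2D (readPoint P (a.eval n ρ))
      (readPoint P (b.eval n ρ)) (readPoint P (c.eval n ρ)) < 0 := by
  simp only [turnTest, Test.Holds, RExp.eval, orientation2D, sub_pos, sub_neg]

theorem cost_dirTest : (dirTest d a b).cost = 3 * a.cost + 3 * b.cost + 21 := by
  simp only [dirTest, Test.cost, RExp.cost]
  ring

theorem cost_keyTest : (keyTest d a b).cost = 8 * a.cost + 8 * b.cost + 53 := by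
  simp only [keyTest, Test.cost, WExp.cost, cost_dirTest]
  ring

theorem cost_turnTest : (turnTest a b c).cost = 4 * a.cost + 2 * b.cost + 2 * c.cost + 16 := by
  simp only [turnTest, Test.cost, RExp.cost]
  ring

theorem lexKey_le_of_sortKey_le {i j : ℕ} (hj : j < n) (h : sortKey P d i ≤ sortKey P d j) :
    lexKey d (readPoint P i) ≤ lexKey d (readPoint P j) := by
  have hi : i < n := by
    by_contra hi
    simp [sortKey, hi, hj] at h
  simp only [sortKey, hi, hj, if_true, WithTop.coe_le_coe] at h
  exact (Prod.Lex.toLex_le_toLex.1 h).elim le_of_lt fun h => h.1.le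

end Tests

/-! ### Streaming the input in sorted order -/

section Stream

variable {K : Type*} [LinearOrder K] {key : ℕ → K} {n S e g g' : ℕ} {A B C : ℕ → Prop}

/-- `key` sorts the positions below `n` without ties; the position `n` marks the end of the
stream. -/
structure IsSortKey (key : ℕ → K) (n : ℕ) : Prop where
  lt_end : ∀ i < n, key i < key n
  injOn : Set.InjOn key (Set.Iio n)

theorem isSortKey_sortKey (P : Fin n → ℝ × ℝ) (d : ℤˣ) : IsSortKey (sortKey P d) n where
  lt_end i hi := by simp [sortKey, hi]
  injOn i hi j hj h := by
    simp only [sortKey, Set.mem_Iio.1 hi, Set.mem_Iio.1 hj, if_true, WithTop.coe_inj] at h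
    exact congrArg (fun x => (ofLex x).2) h

/-- `g` is the first position with the property `A`, or `n` if there is none. -/
structure IsFirst (key : ℕ → K) (n : ℕ) (A : ℕ → Prop) (g : ℕ) : Prop where
  le : g ≤ n
  prop : g < n → A g
  le_key : ∀ i < n, A i → key g ≤ key i

theorem IsFirst.congr (h : IsFirst key n A g) (hAB : ∀ i < n, A i ↔ B i) : IsFirst key n B g :=
  ⟨h.le, fun hg => (hAB g hg).1 (h.prop hg), fun i hi hB => h.le_key i hi ((hAB i hi).2 hB)⟩

theorem IsFirst.or (hA : IsFirst key n A g) (hB : IsFirst key n B g')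
    (hC : ∀ i < n, C i ↔ A i ∨ B i) :
    IsFirst key n C (if key g' < key g then g' else g) := by
  have hle : key (if key g' < key g then g' else g) ≤ key g ∧
      key (if key g' < key g then g' else g) ≤ key g' := by
    split_ifs with h
    exacts [⟨h.le, le_rfl⟩, ⟨le_rfl, not_lt.1 h⟩]
  refine ⟨?_, fun hn => (hC _ hn).2 ?_, fun i hi hCi => ?_⟩
  · split_ifs
    exacts [hB.le, hA.le]
  · split_ifs at hn ⊢
    exacts [Or.inr (hB.prop hn), Or.inl (hA.prop hn)]
  · exact ((hC i hi).1 hCi).elim (fun h => hle.1.trans (hA.le_key i hi h))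
      fun h => hle.2.trans (hB.le_key i hi h)

theorem isFirst_end (h : ∀ i < n, ¬ A i) : IsFirst key n A n :=
  ⟨le_rfl, fun hn => absurd hn (lt_irrefl n), fun i hi hA => absurd hA (h i hi)⟩

theorem isFirst_block_start {q : ℕ} : IsFirst key n (fun i => i < q * S ∧ i / S = q ∧ A i) n :=
  isFirst_end fun i _ ⟨hi, hiq, _⟩ => hi.not_ge (hiq ▸ Nat.div_mul_le_self i S)

theorem IsFirst.of_block_end {p q : ℕ} (hS : 0 < S)
    (h : IsFirst key n (fun i => i < p ∧ i / S = q ∧ A i) g) (hp : (q + 1) * S ≤ p ∨ n ≤ p) :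
    IsFirst key n (fun i => i / S = q ∧ A i) g := by
  refine h.congr fun i hi => and_iff_right_of_imp fun ⟨hiq, _⟩ => ?_
  have hlt : i < (q + 1) * S := (Nat.div_lt_iff_lt_mul hS).1 (hiq.trans_lt q.lt_succ_self)
  exact hp.elim hlt.trans_le hi.trans_le

theorem isFirst_eq (hg : g < n) : IsFirst key n (· = g) g :=
  ⟨hg.le, fun _ => rfl, fun _ _ h => h ▸ le_rfl⟩

/-- The positions that come after `e`; all of them for `e = n`. -/
def After (key : ℕ → K) (n e i : ℕ) : Prop := e = n ∨ key e < key i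

theorem after_iff_of_isFirst (hkey : IsSortKey key n) (hg : IsFirst key n (After key n e) g)
    (hgn : g < n) {i : ℕ} (hi : i < n) : After key n e i ↔ i = g ∨ key g < key i := by
  constructor
  · intro h
    rcases (hg.le_key i hi h).eq_or_lt with h | h
    exacts [Or.inl (hkey.injOn hi hgn h.symm), Or.inr h]
  · rintro (rfl | h)
    exacts [hg.prop hgn, (hg.prop hgn).imp_right fun heg => heg.trans h]

theorem isFirst_lt (hkey : IsSortKey key n) (hn : 0 < n) (hg : IsFirst key n (After key n n) g) :
    g < n := by
  refine lt_of_le_of_ne hg.le ?_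
  rintro rfl
  exact (hkey.lt_end 0 hn).not_ge (hg.le_key 0 hn (Or.inl rfl))

theorem key_lt_of_isFirst_after (hkey : IsSortKey key n) (he : e < n)
    (hg : IsFirst key n (After key n e) g) : key e < key g := by
  rcases hg.le.lt_or_eq with h | rfl
  exacts [(hg.prop h).resolve_left he.ne, hkey.lt_end e he]

theorem key_le_iff_of_isFirst_after (hkey : IsSortKey key n) (he : e < n)
    (hg : IsFirst key n (After key n e) g) {i : ℕ} (hi : i < n) :
    key e ≤ key i ↔ i = e ∨ key g ≤ key i := by
  constructor
  · intro h
    rcases h.eq_or_lt with h | h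
    exacts [Or.inl (hkey.injOn hi he h.symm), Or.inr (hg.le_key i hi (Or.inr h))]
  · rintro (rfl | h)
    exacts [le_rfl, (key_lt_of_isFirst_after hkey he hg).le.trans h]

/-- The number of positions that `e` does not come after. -/
def pendingCount (key : ℕ → K) (n e : ℕ) : ℕ := (Finset.range n |>.filter (key e ≤ key ·)).card

theorem pendingCount_le : pendingCount key n e ≤ n :=
  (Finset.card_filter_le _ _).trans_eq (Finset.card_range n)

theorem pendingCount_eq_succ (hkey : IsSortKey key n) (he : e < n)
    (hg : IsFirst key n (After key n e) g) :
    pendingCount key n e = pendingCount key n g + 1 := by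
  rw [pendingCount, pendingCount, ← Finset.card_insert_of_notMem (a := e)]
  · congr 1
    ext i
    simp only [Finset.mem_filter, Finset.mem_insert, Finset.mem_range]
    constructor
    · rintro ⟨hi, h⟩
      exact ((key_le_iff_of_isFirst_after hkey he hg hi).1 h).imp_right fun h => ⟨hi, h⟩
    · rintro (rfl | ⟨hi, h⟩)
      exacts [⟨he, le_rfl⟩, ⟨hi, (key_le_iff_of_isFirst_after hkey he hg hi).2 (Or.inr h)⟩]
  · simp [key_lt_of_isFirst_after hkey he hg]

/-- `M` holds the first position after `e` of each block of `S` consecutive positions. -/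
def BlockFirsts (key : ℕ → K) (n S e : ℕ) (M : ℕ → ℕ) : Prop :=
  ∀ q < S, IsFirst key n (fun i => i / S = q ∧ After key n e i) (M q)

theorem BlockFirsts.update {M : ℕ → ℕ} (hkey : IsSortKey key n) (hM : BlockFirsts key n S e M)
    (hg : IsFirst key n (After key n e) g) (hgn : g < n)
    (hg' : IsFirst key n (fun i => i / S = g / S ∧ After key n g i) g') :
    BlockFirsts key n S g (Function.update M (g / S) g') := by
  intro q hq
  rcases eq_or_ne q (g / S) with rfl | hne
  · rwa [Function.update_self]
  · rw [Function.update_of_ne hne]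
    refine (hM q hq).congr fun i hi => and_congr_right fun hiq => ?_
    have hig : i ≠ g := fun h => hne (h ▸ hiq.symm)
    rw [after_iff_of_isFirst hkey hg hgn hi, or_iff_right hig, After, or_iff_right hgn.ne]

end Stream

/-! ### The stack -/

section Stack

variable {n : ℕ} {P : Fin n → ℝ × ℝ} {d : ℤˣ} {St : ℕ → ℕ} {t top e e' : ℕ} {O : List (ℝ × ℝ)}

/-- The points on a stack of height `t`, latest first. -/
noncomputable def stackPts (P : Fin n → ℝ × ℝ) (St : ℕ → ℕ) : ℕ → List (ℝ × ℝ)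
  | 0 => []
  | t + 1 => readPoint P (St t) :: stackPts P St t

theorem stackPts_push :
    stackPts P (Function.update St t e) (t + 1) = readPoint P e :: stackPts P St t := by
  have hcongr : ∀ t' ≤ t, stackPts P (Function.update St t e) t' = stackPts P St t' := by
    intro t' ht'
    induction t' with
    | zero => rfl
    | succ t' ih =>
      rw [stackPts, stackPts, ih (by omega), Function.update_of_ne (by omega : t' ≠ t)]
  rw [stackPts, Function.update_self, hcongr t le_rfl]

theorem mem_range_of_mem_stackPts (h : ∀ j < t, St j < n) {z : ℝ × ℝ} (hz : z ∈ stackPts P St t) :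
    z ∈ Set.range P := by
  induction t with
  | zero => exact absurd hz List.not_mem_nil
  | succ t ih =>
    rcases List.mem_cons.1 hz with rfl | hz
    · exact readPoint_mem_range (h t t.lt_succ_self)
    · exact ih (fun j hj => h j (by omega)) hz

/-- The point `c` does not show that `b`, which comes after `a`, is off the hull. -/
def Keeps (d : ℤˣ) (a b c : ℝ × ℝ) : Prop := lexKey d b < lexKey d c → orientation2D a b c < 0

/-- The stack `St` of height `top`, on top of the points `O` reported already (latest first), is a
chain that covers all positions before `e`; its lowest point is final. -/
structure StackInv (P : Fin n → ℝ × ℝ) (d : ℤˣ) (St : ℕ → ℕ) (top e : ℕ)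
    (O : List (ℝ × ℝ)) : Prop where
  pos : 0 < top
  lt : ∀ j < top, St j < n
  mem : ∀ z ∈ O, z ∈ Set.range P
  chain : TurnChain d (stackPts P St top ++ O)
  cover : ∀ i < n, sortKey P d i < sortKey P d e →
    readPoint P i ∈ stackPts P St top ++ O ∨ RightOfSegment d (Set.range P) (readPoint P i)
  order : ∀ i < n, sortKey P d e ≤ sortKey P d i →
    lexKey d (readPoint P (St (top - 1))) ≤ lexKey d (readPoint P i)
  base : ∀ a ∈ O.head?, ∀ i < n, sortKey P d e ≤ sortKey P d i →
    Keeps d a (readPoint P (St 0)) (readPoint P i)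

theorem sortKey_le_of_next (he : e < n)
    (he' : IsFirst (sortKey P d) n (After (sortKey P d) n e) e') {i : ℕ}
    (h : sortKey P d e' ≤ sortKey P d i) : sortKey P d e ≤ sortKey P d i :=
  (key_lt_of_isFirst_after (isSortKey_sortKey P d) he he').le.trans h

theorem eq_or_sortKey_lt_of_next (he : e < n)
    (he' : IsFirst (sortKey P d) n (After (sortKey P d) n e) e') {i : ℕ} (hi : i < n)
    (h : sortKey P d i < sortKey P d e') : i = e ∨ sortKey P d i < sortKey P d e := by
  by_contra! hne
  exact ((key_le_iff_of_isFirst_after (isSortKey_sortKey P d) he he' hi).1 hne.2).elim hne.1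
    h.not_ge

theorem stackInv_singleton (he : e < n)
    (hfirst : IsFirst (sortKey P d) n (After (sortKey P d) n n) e)
    (he' : IsFirst (sortKey P d) n (After (sortKey P d) n e) e') :
    StackInv P d (Function.update St 0 e) 1 e' [] where
  pos := one_pos
  lt j hj := by
    obtain rfl : j = 0 := by omega
    rwa [Function.update_self]
  mem := List.forall_mem_nil _
  chain := trivial
  cover i hi h := by
    obtain rfl := (eq_or_sortKey_lt_of_next he he' hi h).resolve_right
      (hfirst.le_key i hi (Or.inl rfl)).not_gt
    exact Or.inl (by simp [stackPts])
  order i hi h := by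
    rw [Nat.sub_self, Function.update_self]
    exact lexKey_le_of_sortKey_le hi (sortKey_le_of_next he he' h)
  base := by simp

theorem StackInv.pop (h : StackInv P d St top e O) (htop : 1 < top) {c : ℕ} (hc : c < n)
    (hbad : ¬ Keeps d (readPoint P (St (top - 2))) (readPoint P (St (top - 1)))
      (readPoint P c)) :
    StackInv P d St (top - 1) e O := by
  obtain ⟨t, rfl⟩ : ∃ t, top = t + 2 := ⟨top - 2, by omega⟩
  have hchain := h.chain
  simp only [stackPts, List.cons_append] at hchain
  simp only [Keeps, not_forall, not_lt] at hbad
  obtain ⟨hlt, hturn⟩ := hbad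
  refine ⟨t.succ_pos, fun j hj => h.lt j (by omega), h.mem, hchain.tail, fun i hi hie => ?_,
    fun i hi hei => hchain.1.le.trans (h.order i hi hei), h.base⟩
  rcases h.cover i hi hie with hmem | hright
  · rcases List.mem_cons.1 hmem with heq | hmem
    · rw [heq]
      exact Or.inr ⟨_, readPoint_mem_range (h.lt t (by omega)), _, readPoint_mem_range hc,
        hchain.1, hlt, hturn⟩
    · exact Or.inl hmem
  · exact Or.inr hright

theorem StackInv.skip (h : StackInv P d St top e O) (he : e < n)
    (he' : IsFirst (sortKey P d) n (After (sortKey P d) n e) e')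
    (hge : ¬ lexKey d (readPoint P (St (top - 1))) < lexKey d (readPoint P e)) :
    StackInv P d St top e' O := by
  refine ⟨h.pos, h.lt, h.mem, h.chain, fun i hi hlt => ?_,
    fun i hi hle => h.order i hi (sortKey_le_of_next he he' hle),
    fun a ha i hi hle => h.base a ha i hi (sortKey_le_of_next he he' hle)⟩
  rcases eq_or_sortKey_lt_of_next he he' hi hlt with rfl | hlt
  · obtain ⟨t, rfl⟩ : ∃ t, top = t + 1 := ⟨top - 1, by have := h.pos; omega⟩
    have heq : readPoint P i = readPoint P (St t) :=
      lexKey_injective d ((not_lt.1 hge).antisymm (h.order i hi le_rfl))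
    exact Or.inl (by simp [stackPts, heq])
  · exact h.cover i hi hlt

theorem StackInv.turnChain_push (h : StackInv P d St (t + 1) e O) (he : e < n)
    (hlt : lexKey d (readPoint P (St t)) < lexKey d (readPoint P e))
    (hkeep : 1 ≤ t → Keeps d (readPoint P (St (t - 1))) (readPoint P (St t)) (readPoint P e)) :
    TurnChain d (readPoint P e :: (stackPts P St (t + 1) ++ O)) := by
  refine ⟨hlt, ?_, h.chain⟩
  cases t with
  | zero => exact fun a ha => h.base a ha e he le_rfl hlt
  | succ t =>
    intro a ha
    obtain rfl : readPoint P (St t) = a := Option.some.inj ha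
    exact hkeep (by omega) hlt

theorem StackInv.push (h : StackInv P d St top e O) (he : e < n)
    (he' : IsFirst (sortKey P d) n (After (sortKey P d) n e) e')
    (hlt : lexKey d (readPoint P (St (top - 1))) < lexKey d (readPoint P e))
    (hkeep : 1 < top →
      Keeps d (readPoint P (St (top - 2))) (readPoint P (St (top - 1))) (readPoint P e)) :
    StackInv P d (Function.update St top e) (top + 1) e' O := by
  obtain ⟨t, rfl⟩ : ∃ t, top = t + 1 := ⟨top - 1, by have := h.pos; omega⟩
  refine ⟨by omega, fun j hj => ?_, h.mem, ?_, fun i hi hlt => ?_, fun i hi hle => ?_,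
    fun a ha i hi hle => ?_⟩
  · rcases Nat.lt_succ_iff_lt_or_eq.1 hj with hj | rfl
    · exact Function.update_of_ne hj.ne e St ▸ h.lt j hj
    · rwa [Function.update_self]
  · rw [stackPts_push, List.cons_append]
    exact h.turnChain_push he hlt fun ht => hkeep (by omega)
  · rw [stackPts_push, List.cons_append]
    rcases eq_or_sortKey_lt_of_next he he' hi hlt with rfl | hlt
    · exact Or.inl List.mem_cons_self
    · exact (h.cover i hi hlt).imp_left (List.mem_cons_of_mem _)
  · rw [Nat.add_sub_cancel, Function.update_self]
    exact lexKey_le_of_sortKey_le hi (sortKey_le_of_next he he' hle)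
  · rw [Function.update_of_ne (by omega)]
    exact h.base a ha i hi (sortKey_le_of_next he he' hle)

/-- The head of the chain `Z`, if it is not the only point, is kept by the positions below `I` from
`e` on in the sweep. -/
def TopKept (P : Fin n → ℝ × ℝ) (d : ℤˣ) (e I : ℕ) (Z : List (ℝ × ℝ)) : Prop :=
  ∀ u a l, Z = u :: a :: l → ∀ i < n, i < I → sortKey P d e ≤ sortKey P d i →
    Keeps d a u (readPoint P i)

/-- What keeps a point also keeps the point below it, since turns of a chain compose. -/
theorem StackInv.topKept_pop {I : ℕ} (h : StackInv P d St top e O) (htop : 1 < top)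
    (hk : TopKept P d e I (stackPts P St top ++ O)) :
    TopKept P d e I (stackPts P St (top - 1) ++ O) := by
  obtain ⟨t, rfl⟩ : ∃ t, top = t + 2 := ⟨top - 2, by omega⟩
  intro u a l hZ i hi hI hle _
  have hcons : stackPts P St (t + 2) ++ O = readPoint P (St (t + 1)) :: u :: a :: l :=
    congrArg _ hZ
  have hchain := h.chain
  have hkeep := hk _ u (a :: l) hcons i hi hI hle
  rw [hcons] at hchain
  have hturn : orientation2D a u (readPoint P (St (t + 1))) < 0 := hchain.2.1 a rfl
  rcases (h.order i hi hle).eq_or_lt with heq | hlt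
  · rwa [← lexKey_injective d heq]
  · exact (turn_trans hchain.2.2.1 hchain.1 hlt hturn (hkeep hlt)).1

theorem StackInv.topKept_succ {I : ℕ} (h : StackInv P d St top e O)
    (hk : TopKept P d e I (stackPts P St top ++ O))
    (hnew : 1 < top → sortKey P d e ≤ sortKey P d I →
      Keeps d (readPoint P (St (top - 2))) (readPoint P (St (top - 1))) (readPoint P I)) :
    TopKept P d e (I + 1) (stackPts P St top ++ O) := by
  intro u a l hZ i hi hI hle
  rcases Nat.lt_succ_iff_lt_or_eq.1 hI with hI | rfl
  · exact hk u a l hZ i hi hI hle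
  obtain ⟨t, rfl⟩ : ∃ t, top = t + 1 := ⟨top - 1, by have := h.pos; omega⟩
  cases t with
  | zero =>
    simp only [stackPts, List.cons_append, List.nil_append, List.cons.injEq] at hZ
    obtain ⟨rfl, rfl⟩ := hZ
    exact h.base a rfl i hi hle
  | succ t =>
    simp only [stackPts, List.cons_append, List.cons.injEq] at hZ
    obtain ⟨rfl, rfl, -⟩ := hZ
    exact hnew (by omega) hle

theorem StackInv.flush (h : StackInv P d St top e O)
    (hk : TopKept P d e n (stackPts P St top ++ O)) :
    StackInv P d (Function.update St 0 (St (top - 1))) 1 e (stackPts P St (top - 1) ++ O) := by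
  obtain ⟨t, rfl⟩ : ∃ t, top = t + 1 := ⟨top - 1, by have := h.pos; omega⟩
  rw [Nat.add_sub_cancel]
  have hst : stackPts P (Function.update St 0 (St t)) 1 ++ (stackPts P St t ++ O) =
      stackPts P St (t + 1) ++ O := by
    rw [stackPts_push]
    rfl
  refine ⟨one_pos, fun j hj => ?_, fun z hz => ?_, hst ▸ h.chain,
    fun i hi hlt => hst ▸ h.cover i hi hlt, fun i hi hle => ?_, fun a ha i hi hle => ?_⟩
  · obtain rfl : j = 0 := by omega
    exact Function.update_self 0 (St t) St ▸ h.lt t t.lt_succ_self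
  · rcases List.mem_append.1 hz with hz | hz
    · exact mem_range_of_mem_stackPts (fun j hj => h.lt j (by omega)) hz
    · exact h.mem z hz
  · rw [Nat.sub_self, Function.update_self]
    exact h.order i hi hle
  · rw [Function.update_self]
    obtain ⟨l, hl⟩ := List.head?_eq_some_iff.1 ha
    exact hk _ a l (by rw [stackPts, List.cons_append, hl]) i hi hi hle

theorem StackInv.isHullChain (h : StackInv P d St 1 e O) (he : n ≤ e) :
    IsHullChain d (Set.range P) (readPoint P (St 0) :: O).reverse := by
  refine ⟨fun p hp => ?_, List.pairwise_reverse.2 h.chain.pairwise,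
    List.triplewise_reverse.2 h.chain.triplewise, ?_⟩
  · rcases List.mem_cons.1 (List.mem_reverse.1 hp) with rfl | hp
    · exact readPoint_mem_range (h.lt 0 one_pos)
    · exact h.mem p hp
  · rintro _ ⟨i, rfl⟩
    have hi := h.cover i i.2 (by simp [sortKey, he.not_gt])
    rw [readPoint_of_lt i.2] at hi
    exact hi.imp_left List.mem_reverse.2

end Stack

/-! ### The sorted stream on the machine -/

/-- Relations between the number `n` of points, the block size `S` and the word bound `w`. -/
structure Sizes (n S w : ℕ) : Prop where
  pos : 0 < n
  le_sq : n ≤ S * S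
  sq_lt : ∀ k < S, k * k < n
  lt_word : n + 1 < w
  sq_lt_word : S * S < w

theorem Sizes.size_pos {n S w : ℕ} (hs : Sizes n S w) : 0 < S :=
  Nat.pos_of_mul_pos_left (hs.pos.trans_le hs.le_sq)

theorem Sizes.size_le {n S w : ℕ} (hs : Sizes n S w) : S ≤ n := by
  have hlt := hs.sq_lt (S - 1) (Nat.sub_lt hs.size_pos one_pos)
  have := Nat.le_mul_self (S - 1)
  omega

/-- Register: the block size. -/
local notation "rSize" => (0 : Fin 10)
/-- Register: the next position of the sorted stream. -/
local notation "rNext" => (1 : Fin 10)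
/-- Register: the height of the stack. -/
local notation "rTop" => (2 : Fin 10)
/-- Register: an input position, or a stack index while the stack is reported. -/
local notation "rPos" => (3 : Fin 10)
/-- Register: the least position found by a search. -/
local notation "rBest" => (4 : Fin 10)
/-- Register: a block. -/
local notation "rBlock" => (5 : Fin 10)
/-- Register: the second cell of the stack. -/
local notation "rBelow" => (6 : Fin 10)
/-- Register: the top cell of the stack. -/
local notation "rUpper" => (7 : Fin 10)
/-- Register: the number of positions of the current batch. -/
local notation "rCount" => (8 : Fin 10)
/-- Register: a position read from `aFirst`. -/
local notation "rCand" => (9 : Fin 10)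
/-- Array: the first positions of the blocks. -/
local notation "aFirst" => (0 : Fin 2)
/-- Array: the stack. -/
local notation "aStack" => (1 : Fin 2)

local infixr:40 ";;" => Prog.seq

theorem sub_mul_eq_sub_succ_mul_add {a b : ℕ} (h : b < a) (c : ℕ) :
    (a - b) * c = (a - (b + 1)) * c + c := by
  rw [← Nat.succ_mul]
  congr 1
  omega

section Streaming

variable {n S s w : ℕ} {P : Fin n → ℝ × ℝ} {d : ℤˣ} {σ : State 10 2}

/-- Take the position `rPos` into account in the search of `refresh`. -/
def refreshStep (d : ℤˣ) : Prog 10 2 :=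
  .ite (.and (.or (.eq (.reg rNext) .len) (keyTest d (.reg rNext) (.reg rPos)))
      (keyTest d (.reg rPos) (.reg rBest)))
    (.assign rBest (.reg rPos)) .skip ;;
  .assign rPos (.add (.reg rPos) (.lit 1))

/-- Store the first position after `rNext` of block `rBlock`. -/
def refresh (d : ℤˣ) : Prog 10 2 :=
  .assign rPos (.mul (.reg rBlock) (.reg rSize)) ;;
  .assign rBest .len ;;
  .loop (.and (.lt (.reg rPos) (.mul (.add (.reg rBlock) (.lit 1)) (.reg rSize)))
      (.lt (.reg rPos) .len))
    (refreshStep d) ;;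
  .store aFirst (.reg rBlock) (.reg rBest)

/-- Take block `rBlock` into account in the search of `findNext`. -/
def findNextStep (d : ℤˣ) : Prog 10 2 :=
  .load rCand aFirst (.reg rBlock) ;;
  .ite (keyTest d (.reg rCand) (.reg rBest)) (.assign rBest (.reg rCand)) .skip ;;
  .assign rBlock (.add (.reg rBlock) (.lit 1))

/-- Search the blocks for the first position after `rNext`. -/
def findNext (d : ℤˣ) : Prog 10 2 :=
  .assign rBest .len ;;
  .assign rBlock (.lit 0) ;;
  .loop (.lt (.reg rBlock) (.reg rSize)) (findNextStep d)

/-- Move `rNext` to the next position of the sorted stream. -/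
def next (d : ℤˣ) : Prog 10 2 :=
  findNext d ;;
  .assign rNext (.reg rBest) ;;
  .ite (.lt (.reg rNext) .len)
    (.assign rBlock (.div (.reg rNext) (.reg rSize)) ;; refresh d) .skip

/-- Find the block size `⌈√n⌉`. -/
def findSize : Prog 10 2 :=
  .assign rSize (.lit 0) ;;
  .loop (.lt (.mul (.reg rSize) (.reg rSize)) .len) (.assign rSize (.add (.reg rSize) (.lit 1)))

/-- Start the sorted stream: `rNext` stands before its first position. -/
def start (d : ℤˣ) : Prog 10 2 :=
  findSize ;;
  .assign rNext .len ;;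
  .assign rBlock (.lit 0) ;;
  .loop (.lt (.reg rBlock) (.reg rSize)) (refresh d ;; .assign rBlock (.add (.reg rBlock) (.lit 1)))

theorem wp_refreshStep {q : ℕ} (hw : n + 1 < w) (hpos : σ.reg rPos < n)
    (hdiv : σ.reg rPos / S = q)
    (hbest : IsFirst (sortKey P d) n
      (fun i => i < σ.reg rPos ∧ i / S = q ∧ After (sortKey P d) n (σ.reg rNext) i)
      (σ.reg rBest)) :
    WP P s w (refreshStep d) σ fun t τ => t ≤ 150 ∧ τ.reg rPos = σ.reg rPos + 1 ∧
      IsFirst (sortKey P d) n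
        (fun i => i < σ.reg rPos + 1 ∧ i / S = q ∧ After (sortKey P d) n (σ.reg rNext) i)
        (τ.reg rBest) ∧
      AgreeOff {rPos, rBest} σ τ := by
  have hstep : ∀ i < n,
      (i < σ.reg rPos + 1 ∧ i / S = q ∧ After (sortKey P d) n (σ.reg rNext) i ↔
        (i < σ.reg rPos ∧ i / S = q ∧ After (sortKey P d) n (σ.reg rNext) i) ∨
          i = σ.reg rPos ∧ After (sortKey P d) n (σ.reg rNext) i) := by
    intro i _
    rw [Nat.lt_succ_iff_lt_or_eq, or_and_right]
    exact or_congr_right (and_congr_right fun hi => and_iff_right (hi ▸ hdiv))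
  have hor (hafter : After (sortKey P d) n (σ.reg rNext) (σ.reg rPos)) :=
    hbest.or (isFirst_eq hpos) fun i hi => (hstep i hi).trans
      (or_congr_right (and_iff_left_of_imp fun h => h ▸ hafter))
  have hagree := AgreeOff.refl {rPos, rBest} σ
  simp only [refreshStep, wp_seq, wp_ite, wp_assign, wp_skip, Test.Holds, WExp.eval, WExp.cost,
    Test.cost, holds_keyTest, cost_keyTest, ne_eq, Fin.reduceEq, not_false_eq_true,
    Function.update_self, Function.update_of_ne, true_and]
  refine ⟨fun ⟨hafter, hlt⟩ => ⟨by omega, by omega, by omega, ?_,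
      (hagree.assign (by simp) _).assign (by simp) _⟩,
    fun hnot => ⟨by omega, by omega, ?_, hagree.assign (by simp) _⟩⟩
  · simpa only [if_pos hlt] using hor hafter
  · by_cases hafter : After (sortKey P d) n (σ.reg rNext) (σ.reg rPos)
    · simpa only [if_neg fun h => hnot ⟨hafter, h⟩] using hor hafter
    · exact hbest.congr fun i hi =>
        ((hstep i hi).trans (or_iff_left fun h => hafter (h.1 ▸ h.2))).symm

theorem wp_refresh (hs : Sizes n S w) (hsize : σ.reg rSize = S) (hblock : σ.reg rBlock < S) :
    WP P (S + 1) w (refresh d) σ fun t τ => t ≤ 200 * (S + 1) ∧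
      (∃ g, IsFirst (sortKey P d) n
          (fun i => i / S = σ.reg rBlock ∧ After (sortKey P d) n (σ.reg rNext) i) g ∧
        τ.arr = Function.update σ.arr aFirst
          (Function.update (σ.arr aFirst) (σ.reg rBlock) g)) ∧
      τ.out = σ.out ∧ ∀ r ∉ ({rPos, rBest} : Finset (Fin 10)), τ.reg r = σ.reg r := by
  have hw := hs.lt_word
  have hsq := hs.sq_lt_word
  set q := σ.reg rBlock with hq
  have hlast : (q + 1) * S ≤ S * S := Nat.mul_le_mul_right _ hblock
  have hend : (q + 1) * S = q * S + S := by ring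
  simp only [refresh, wp_seq, wp_assign, WExp.eval, WExp.cost, hsize, ← hq]
  refine ⟨by omega, by omega, ?_⟩
  refine (WP.loop (fun τ => q * S ≤ τ.reg rPos ∧ τ.reg rPos ≤ (q + 1) * S ∧
      IsFirst (sortKey P d) n
        (fun i => i < τ.reg rPos ∧ i / S = q ∧ After (sortKey P d) n (σ.reg rNext) i)
        (τ.reg rBest) ∧
      AgreeOff {rPos, rBest} σ τ)
    (fun τ => 180 * ((q + 1) * S - τ.reg rPos)) ?_ ?_).mono ?_
  · rintro τ ⟨hge, -, hbest, hagree⟩ hc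
    have hnext := hagree.reg rNext (by decide)
    simp only [Test.Holds, WExp.eval, hagree.reg rBlock (by decide),
      hagree.reg rSize (by decide), hsize, ← hq] at hc
    have hdiv : τ.reg rPos / S = q := Nat.div_eq_of_lt_le hge hc.1
    rw [← hnext] at hbest
    refine (wp_refreshStep hw hc.2 hdiv hbest).mono fun t τ' ⟨_, hpos, hbest', hagree'⟩ => ?_
    rw [hpos, ← hnext]
    refine ⟨⟨by omega, by omega, hbest', hagree.trans hagree'⟩, ?_⟩
    simp only [Test.cost, WExp.cost]
    omega
  · simp only [ne_eq, Fin.reduceEq, not_false_eq_true, Function.update_self,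
      Function.update_of_ne]
    exact ⟨le_rfl, by omega, isFirst_block_start,
      ((AgreeOff.refl _ σ).assign (by simp) _).assign (by simp) _⟩
  · rintro t τ ⟨⟨-, -, hbest, hagree⟩, hc, hμ⟩
    have hblock' := hagree.reg rBlock (by decide)
    have hle := hbest.le
    simp only [Test.Holds, Test.cost, WExp.eval, WExp.cost, ne_eq, Fin.reduceEq,
      not_false_eq_true, Function.update_self, Function.update_of_ne, hblock',
      hagree.reg rSize (by decide), hsize, ← hq] at hc hμ
    simp only [wp_store, WExp.eval, WExp.cost, hblock', ← hq]
    exact ⟨by omega, by omega, by omega,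
      ⟨τ.reg rBest, hbest.of_block_end hs.size_pos (by omega), by rw [hagree.arr]⟩,
      hagree.out, hagree.reg⟩

theorem wp_findNextStep (hs : Sizes n S w) (hblock : σ.reg rBlock < S)
    (hfirsts : BlockFirsts (sortKey P d) n S (σ.reg rNext) (σ.arr aFirst))
    (hbest : IsFirst (sortKey P d) n
      (fun i => i / S < σ.reg rBlock ∧ After (sortKey P d) n (σ.reg rNext) i) (σ.reg rBest)) :
    WP P (S + 1) w (findNextStep d) σ fun t τ => t ≤ 80 ∧
      τ.reg rBlock = σ.reg rBlock + 1 ∧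
      IsFirst (sortKey P d) n
        (fun i => i / S < σ.reg rBlock + 1 ∧ After (sortKey P d) n (σ.reg rNext) i)
        (τ.reg rBest) ∧
      AgreeOff {rBest, rBlock, rCand} σ τ := by
  have hSn := hs.size_le
  have hw := hs.lt_word
  have hle := (hfirsts _ hblock).le
  have hagree := AgreeOff.refl {rBest, rBlock, rCand} σ
  have hor := hbest.or (hfirsts _ hblock)
    (C := fun i => i / S < σ.reg rBlock + 1 ∧ After (sortKey P d) n (σ.reg rNext) i)
    fun i _ => by rw [Nat.lt_succ_iff_lt_or_eq, or_and_right]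
  simp only [findNextStep, wp_seq, wp_ite, wp_assign, wp_skip, wp_load, WExp.eval, WExp.cost,
    holds_keyTest, cost_keyTest, ne_eq, Fin.reduceEq, not_false_eq_true,
    Function.update_self, Function.update_of_ne, true_and]
  refine ⟨by omega, fun hlt => ⟨by omega, by omega, by omega, by rwa [if_pos hlt] at hor,
      ((hagree.assign (by simp) _).assign (by simp) _).assign (by simp) _⟩,
    fun hge => ⟨by omega, by omega, by rwa [if_neg hge] at hor,
      (hagree.assign (by simp) _).assign (by simp) _⟩⟩

theorem wp_findNext (hs : Sizes n S w) (hsize : σ.reg rSize = S)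
    (hfirsts : BlockFirsts (sortKey P d) n S (σ.reg rNext) (σ.arr aFirst)) :
    WP P (S + 1) w (findNext d) σ fun t τ => t ≤ 110 * (S + 1) ∧
      IsFirst (sortKey P d) n (After (sortKey P d) n (σ.reg rNext)) (τ.reg rBest) ∧
      AgreeOff {rBest, rBlock, rCand} σ τ := by
  have hw := hs.lt_word
  simp only [findNext, wp_seq, wp_assign, WExp.eval, WExp.cost]
  refine ⟨by omega, by omega, ?_⟩
  refine (WP.loop (fun τ => τ.reg rBlock ≤ S ∧
      IsFirst (sortKey P d) n
        (fun i => i / S < τ.reg rBlock ∧ After (sortKey P d) n (σ.reg rNext) i) (τ.reg rBest) ∧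
      AgreeOff {rBest, rBlock, rCand} σ τ)
    (fun τ => 100 * (S - τ.reg rBlock)) ?_ ?_).mono ?_
  · rintro τ ⟨-, hbest, hagree⟩ hc
    have hnext := hagree.reg rNext (by decide)
    simp only [Test.Holds, WExp.eval, hagree.reg rSize (by decide), hsize] at hc
    rw [← hnext] at hbest
    refine (wp_findNextStep hs hc (by rwa [hnext, hagree.arr]) hbest).mono
      fun t τ' ⟨_, hblock, hbest', hagree'⟩ => ?_
    rw [hblock, ← hnext]
    refine ⟨⟨hc, hbest', hagree.trans hagree'⟩, ?_⟩
    simp only [Test.cost, WExp.cost]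
    omega
  · simp only [ne_eq, Fin.reduceEq, not_false_eq_true, Function.update_self,
      Function.update_of_ne]
    exact ⟨by omega, isFirst_end (by simp),
      ((AgreeOff.refl _ σ).assign (by simp) _).assign (by simp) _⟩
  · rintro t τ ⟨⟨-, hbest, hagree⟩, hc, hμ⟩
    simp only [Test.Holds, Test.cost, WExp.eval, WExp.cost, Function.update_self,
      hagree.reg rSize (by decide), hsize] at hc hμ
    refine ⟨by omega, hbest.congr fun i hi => and_iff_right_of_imp fun _ => ?_, hagree⟩
    have := Nat.div_lt_of_lt_mul (hi.trans_le hs.le_sq)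
    omega

theorem wp_next (hs : Sizes n S w) (hsize : σ.reg rSize = S)
    (hfirsts : BlockFirsts (sortKey P d) n S (σ.reg rNext) (σ.arr aFirst)) :
    WP P (S + 1) w (next d) σ fun t τ => t ≤ 400 * (S + 1) ∧
      IsFirst (sortKey P d) n (After (sortKey P d) n (σ.reg rNext)) (τ.reg rNext) ∧
      (τ.reg rNext < n → BlockFirsts (sortKey P d) n S (τ.reg rNext) (τ.arr aFirst)) ∧
      τ.arr aStack = σ.arr aStack ∧ τ.out = σ.out ∧
      ∀ r ∉ ({rNext, rPos, rBest, rBlock, rCand} : Finset (Fin 10)), τ.reg r = σ.reg r := by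
  have hw := hs.lt_word
  simp only [next, wp_seq]
  refine (wp_findNext hs hsize hfirsts).mono fun t₁ τ₁ ⟨_, hbest, hagree⟩ => ?_
  have hle := hbest.le
  have hagree' : AgreeOff {rNext, rPos, rBest, rBlock, rCand} σ τ₁ := hagree.mono (by decide)
  simp only [wp_ite, wp_seq, wp_assign, wp_skip, Test.Holds, WExp.eval, WExp.cost, Test.cost,
    Function.update_self]
  refine ⟨by omega, fun hlt => ?_, fun hge => ?_⟩
  · have hdiv := Nat.div_lt_of_lt_mul (hlt.trans_le hs.le_sq)
    have hsize₁ := (hagree.reg rSize (by decide)).trans hsize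
    have hSn := hs.size_le
    simp only [ne_eq, Fin.reduceEq, not_false_eq_true, Function.update_of_ne, hsize₁]
    refine ⟨by omega, (wp_refresh hs (by simpa using hsize₁) (by simpa using hdiv)).mono ?_⟩
    rintro t₂ τ₂ ⟨ht₂, ⟨g, hg, harr⟩, hout, hreg⟩
    simp only [ne_eq, Fin.reduceEq, not_false_eq_true, Function.update_self,
      Function.update_of_ne] at hg harr hout
    have hnext : τ₂.reg rNext = τ₁.reg rBest := by
      rw [hreg rNext (by decide)]
      simp
    refine ⟨by omega, hnext ▸ hbest, fun _ => ?_, ?_, hout.trans hagree.out, fun r hr => ?_⟩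
    · rw [hnext, harr, Function.update_self, hagree.arr]
      exact hfirsts.update (isSortKey_sortKey P d) hbest hlt hg
    · rw [harr, hagree.arr, Function.update_of_ne (by decide)]
    · exact (hreg r (Finset.notMem_mono (by decide) hr)).trans
        (((hagree'.assign (by simp) _).assign (by simp) _).reg r hr)
  · exact ⟨by omega, hbest, fun h => absurd h hge, congrFun hagree.arr _, hagree.out,
      (hagree'.assign (by simp) _).reg⟩

theorem wp_findSize (hs : Sizes n S w) :
    WP P s w findSize σ fun t τ => t ≤ 30 * (S + 1) ∧ τ.reg rSize = S ∧ τ.out = σ.out := by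
  have hw := hs.lt_word
  have hSn := hs.size_le
  simp only [findSize, wp_seq, wp_assign, WExp.eval, WExp.cost]
  refine ⟨by omega, ?_⟩
  refine (WP.loop (fun τ => τ.reg rSize ≤ S ∧ τ.out = σ.out)
    (fun τ => 20 * (S - τ.reg rSize)) ?_ ?_).mono ?_
  · rintro τ ⟨hle, hout⟩ hc
    have hlt : τ.reg rSize < S := lt_of_le_of_ne hle fun h => by
      simp only [Test.Holds, WExp.eval, h] at hc
      exact hc.not_ge hs.le_sq
    simp only [wp_assign, WExp.eval, WExp.cost, Test.cost, Function.update_self]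
    exact ⟨by omega, ⟨hlt, hout⟩, by omega⟩
  · simp
  · rintro t τ ⟨⟨hle, hout⟩, hc, hμ⟩
    simp only [Test.cost, WExp.cost, Function.update_self] at hμ
    refine ⟨by omega, hle.antisymm (not_lt.1 fun hlt => hc (hs.sq_lt _ hlt)), hout⟩

theorem wp_start (hs : Sizes n S w) :
    WP P (S + 1) w (start d) σ fun t τ => t ≤ 300 * ((S + 1) * (S + 1)) ∧ τ.reg rSize = S ∧
      τ.reg rNext = n ∧ BlockFirsts (sortKey P d) n S n (τ.arr aFirst) ∧ τ.out = σ.out := by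
  have hw := hs.lt_word
  have hSn := hs.size_le
  simp only [start, wp_seq]
  refine (wp_findSize hs).mono fun t₁ τ₁ ⟨_, hsize₁, hout₁⟩ => ?_
  simp only [wp_assign, WExp.eval, WExp.cost]
  refine ⟨by omega, by omega, ?_⟩
  refine (WP.loop (fun τ => τ.reg rSize = S ∧ τ.reg rNext = n ∧ τ.reg rBlock ≤ S ∧
      (∀ q < τ.reg rBlock, IsFirst (sortKey P d) n
        (fun i => i / S = q ∧ After (sortKey P d) n n i) (τ.arr aFirst q)) ∧
      τ.out = σ.out)
    (fun τ => (S - τ.reg rBlock) * (250 * (S + 1))) ?_ ?_).mono ?_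
  · rintro τ ⟨hsize, hnext, -, hfirsts, hout⟩ hc
    simp only [Test.Holds, WExp.eval, hsize] at hc
    simp only [wp_seq]
    refine (wp_refresh hs hsize hc).mono fun t τ' ⟨_, ⟨g, hg, harr⟩, hout', hreg⟩ => ?_
    simp only [wp_assign, WExp.eval, WExp.cost, Test.cost, ne_eq, Fin.reduceEq,
      not_false_eq_true, Function.update_self, Function.update_of_ne, hreg rSize (by decide),
      hreg rNext (by decide), hreg rBlock (by decide), hsize, hnext, harr, true_and]
    have hpay := sub_mul_eq_sub_succ_mul_add hc (250 * (S + 1))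
    refine ⟨by omega, ⟨hc, fun q hq => ?_, hout'.trans hout⟩, by omega⟩
    rcases Nat.lt_succ_iff_lt_or_eq.1 hq with hq | rfl
    · rw [Function.update_of_ne hq.ne]
      exact hfirsts q hq
    · rw [hnext] at hg
      rwa [Function.update_self]
  · simpa using ⟨hsize₁, hout₁⟩
  · rintro t τ ⟨⟨hsize, hnext, -, hfirsts, hout⟩, hc, hμ⟩
    simp only [Test.Holds, WExp.eval, Test.cost, WExp.cost, Function.update_self, hsize,
      Nat.sub_zero] at hc hμ
    refine ⟨?_, hsize, hnext, fun q hq => hfirsts q (by omega), hout⟩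
    nlinarith

end Streaming

/-! ### The hull program -/

section Hull

variable {n S s w : ℕ} {P : Fin n → ℝ × ℝ} {d : ℤˣ} {out₀ O : List (ℝ × ℝ)} {σ : State 10 2}

/-- The test that position `c` shows that `b` is off the hull, given the earlier position `a`. -/
def badTest (d : ℤˣ) (a b c : WExp 10) : Test 10 := .and (dirTest d b c) (.not (turnTest a b c))

/-- Load the two topmost cells of the stack. -/
def loadTop : Prog 10 2 :=
  .load rUpper aStack (.sub (.reg rTop) (.lit 1)) ;;
  .load rBelow aStack (.sub (.reg rTop) (.lit 2))

/-- Pop the stack. -/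
def pop : Prog 10 2 := .assign rTop (.sub (.reg rTop) (.lit 1))

/-- Push the next position of the stream, unless its point is on top already, and move on. -/
def advance (d : ℤˣ) : Prog 10 2 :=
  .ite (dirTest d (.reg rUpper) (.reg rNext))
    (.store aStack (.reg rTop) (.reg rNext) ;; .assign rTop (.add (.reg rTop) (.lit 1))) .skip ;;
  .assign rCount (.add (.reg rCount) (.lit 1)) ;;
  next d

/-- Pop the top of the stack if the next position of the stream shows it to be off the hull;
otherwise advance. -/
def pushBatchStep (d : ℤˣ) : Prog 10 2 :=
  loadTop ;;
  .ite (.and (.lt (.lit 1) (.reg rTop)) (badTest d (.reg rBelow) (.reg rUpper) (.reg rNext)))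
    pop (advance d)

/-- Push up to `rSize` positions of the stream. -/
def pushBatch (d : ℤˣ) : Prog 10 2 :=
  .assign rCount (.lit 0) ;;
  .loop (.and (.lt (.reg rNext) .len) (.lt (.reg rCount) (.reg rSize))) (pushBatchStep d)

/-- Pop the top of the stack if position `rPos` is still to come and shows it to be off the hull;
otherwise go on to the following position. -/
def filterBatchStep (d : ℤˣ) : Prog 10 2 :=
  loadTop ;;
  .ite (.and (.lt (.lit 1) (.reg rTop)) (.and (.not (keyTest d (.reg rPos) (.reg rNext)))
      (badTest d (.reg rBelow) (.reg rUpper) (.reg rPos))))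
    pop (.assign rPos (.add (.reg rPos) (.lit 1)))

/-- Pop what the positions still to come show to be off the hull. -/
def filterBatch (d : ℤˣ) : Prog 10 2 :=
  .assign rPos (.lit 0) ;;
  .loop (.lt (.reg rPos) .len) (filterBatchStep d)

/-- Report all of the stack but its top. -/
def reportStack : Prog 10 2 :=
  .assign rPos (.lit 0) ;;
  .loop (.lt (.add (.reg rPos) (.lit 1)) (.reg rTop))
    (.load rBelow aStack (.reg rPos) ;;
    .report (.reg rBelow) ;;
    .assign rPos (.add (.reg rPos) (.lit 1)))

/-- Report all of the stack but its top, which becomes the new bottom. -/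
def flushBatch : Prog 10 2 :=
  reportStack ;;
  .load rUpper aStack (.reg rPos) ;;
  .store aStack (.lit 0) (.reg rUpper) ;;
  .assign rTop (.lit 1)

/-- Start the stream and push its first position. -/
def startPass (d : ℤˣ) : Prog 10 2 :=
  start d ;;
  next d ;;
  .store aStack (.lit 0) (.reg rNext) ;;
  .assign rTop (.lit 1) ;;
  next d

/-- Push, filter and report a batch. -/
def passBatch (d : ℤˣ) : Prog 10 2 := pushBatch d ;; filterBatch d ;; flushBatch

/-- Report the hull chain of direction `d` except for its last point. -/
def pass (d : ℤˣ) : Prog 10 2 := startPass d ;; .loop (.lt (.reg rNext) .len) (passBatch d)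

/-- Report point `0` if all points are equal. -/
def reportIfConstant : Prog 10 2 :=
  .assign rPos (.lit 0) ;;
  .loop (.and (.lt (.reg rPos) .len)
      (.not (.or (dirTest 1 (.lit 0) (.reg rPos)) (dirTest 1 (.reg rPos) (.lit 0)))))
    (.assign rPos (.add (.reg rPos) (.lit 1))) ;;
  .ite (.lt (.reg rPos) .len) .skip (.report (.lit 0))

/-- Report the vertices of the convex hull in clockwise order. -/
def hullProg : Prog 10 2 := reportIfConstant ;; pass 1 ;; pass (-1)

/-- The state between the steps of a pass that has reported `O`, latest first, after `out₀`. -/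
structure PassInv (P : Fin n → ℝ × ℝ) (d : ℤˣ) (S : ℕ) (out₀ O : List (ℝ × ℝ))
    (σ : State 10 2) : Prop where
  size : σ.reg rSize = S
  blocks : σ.reg rNext < n → BlockFirsts (sortKey P d) n S (σ.reg rNext) (σ.arr aFirst)
  stack : StackInv P d (σ.arr aStack) (σ.reg rTop) (σ.reg rNext) O
  out : σ.out = out₀ ++ O.reverse

theorem PassInv.of_agreeOff (h : PassInv P d S out₀ O σ) {R : Finset (Fin 10)} {τ : State 10 2}
    (hτ : AgreeOff R σ τ) (hR : Disjoint {rSize, rNext, rTop} R) : PassInv P d S out₀ O τ := by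
  have hreg : ∀ r ∈ ({rSize, rNext, rTop} : Finset (Fin 10)), τ.reg r = σ.reg r :=
    fun r hr => hτ.reg r (Finset.disjoint_left.1 hR hr)
  refine ⟨?_, ?_, ?_, hτ.out.trans h.out⟩
  · rw [hreg rSize (by decide), h.size]
  · rw [hreg rNext (by decide), hτ.arr]
    exact h.blocks
  · rw [hreg rNext (by decide), hreg rTop (by decide), hτ.arr]
    exact h.stack

theorem PassInv.pop (h : PassInv P d S out₀ O σ) (htop : 1 < σ.reg rTop) {c : ℕ} (hc : c < n)
    (hbad : ¬ Keeps d (readPoint P (σ.arr aStack (σ.reg rTop - 2)))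
      (readPoint P (σ.arr aStack (σ.reg rTop - 1))) (readPoint P c)) :
    PassInv P d S out₀ O { σ with reg := Function.update σ.reg rTop (σ.reg rTop - 1) } :=
  ⟨by simpa using h.size, by simpa using h.blocks, by simpa using h.stack.pop htop hc hbad, h.out⟩

theorem holds_badTest {ρ : Fin 10 → ℕ} {a b c : WExp 10} :
    (badTest d a b c).Holds P ρ ↔ ¬ Keeps d (readPoint P (a.eval n ρ))
      (readPoint P (b.eval n ρ)) (readPoint P (c.eval n ρ)) := by
  simp only [badTest, Test.Holds, holds_dirTest, holds_turnTest, Keeps, Classical.not_imp]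

theorem cost_badTest {a b c : WExp 10} :
    (badTest d a b c).cost = 4 * a.cost + 5 * b.cost + 5 * c.cost + 39 := by
  simp only [badTest, Test.cost, cost_dirTest, cost_turnTest]
  ring

theorem wp_loadTop (hpos : 0 < σ.reg rTop) (hle : σ.reg rTop ≤ s) :
    WP P s w loadTop σ fun t τ => t ≤ 8 ∧ AgreeOff {rUpper, rBelow} σ τ ∧
      τ.reg rUpper = σ.arr aStack (σ.reg rTop - 1) ∧
      τ.reg rBelow = σ.arr aStack (σ.reg rTop - 2) := by
  simp only [loadTop, wp_seq, wp_load, WExp.eval, WExp.cost, ne_eq, Fin.reduceEq,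
    not_false_eq_true, Function.update_self, Function.update_of_ne, and_true]
  exact ⟨by omega, by omega, by omega,
    ((AgreeOff.refl _ σ).assign (by simp) _).assign (by simp) _⟩

theorem wp_next_passInv (hs : Sizes n S w) (hnext : σ.reg rNext < n) (hsize : σ.reg rSize = S)
    (hfirsts : BlockFirsts (sortKey P d) n S (σ.reg rNext) (σ.arr aFirst))
    (hstack : ∀ e', IsFirst (sortKey P d) n (After (sortKey P d) n (σ.reg rNext)) e' →
      StackInv P d (σ.arr aStack) (σ.reg rTop) e' O)
    (hout : σ.out = out₀ ++ O.reverse) :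
    WP P (S + 1) w (next d) σ fun t τ => t ≤ 400 * (S + 1) ∧ PassInv P d S out₀ O τ ∧
      τ.reg rTop = σ.reg rTop ∧ τ.reg rCount = σ.reg rCount ∧
      pendingCount (sortKey P d) n (σ.reg rNext) =
        pendingCount (sortKey P d) n (τ.reg rNext) + 1 := by
  refine (wp_next hs hsize hfirsts).mono
    fun t τ ⟨ht, hfirst, hblocks, hstack', hout', hreg⟩ => ?_
  have htop := hreg rTop (by decide)
  refine ⟨ht, ⟨(hreg rSize (by decide)).trans hsize, hblocks, ?_, hout'.trans hout⟩, htop,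
    hreg rCount (by decide), pendingCount_eq_succ (isSortKey_sortKey P d) hnext hfirst⟩
  rw [htop, hstack']
  exact hstack _ hfirst

theorem wp_advance (hs : Sizes n S w) (h : PassInv P d S out₀ O σ) (hnext : σ.reg rNext < n)
    (hcount : σ.reg rCount < S) (htop : σ.reg rTop ≤ S)
    (hupper : σ.reg rUpper = σ.arr aStack (σ.reg rTop - 1))
    (hkeep : 1 < σ.reg rTop → Keeps d (readPoint P (σ.arr aStack (σ.reg rTop - 2)))
      (readPoint P (σ.arr aStack (σ.reg rTop - 1))) (readPoint P (σ.reg rNext))) :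
    WP P (S + 1) w (advance d) σ fun t τ => t ≤ 400 * (S + 1) + 50 ∧
      PassInv P d S out₀ O τ ∧ τ.reg rTop ≤ σ.reg rTop + 1 ∧
      τ.reg rCount = σ.reg rCount + 1 ∧
      pendingCount (sortKey P d) n (σ.reg rNext) =
        pendingCount (sortKey P d) n (τ.reg rNext) + 1 := by
  have hw := hs.lt_word
  have hSn := hs.size_le
  simp only [advance, wp_seq, wp_ite, wp_assign, wp_skip, wp_store, WExp.eval, WExp.cost,
    holds_dirTest, cost_dirTest, hupper, ne_eq, Fin.reduceEq, not_false_eq_true,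
    Function.update_of_ne]
  refine ⟨fun hlt => ⟨by omega, by omega, by omega, by omega, ?_⟩, fun hge => ⟨by omega, ?_⟩⟩
  · refine WP.mono (wp_next_passInv (O := O) (out₀ := out₀) hs ?_ ?_ ?_ (fun e' he' => ?_) ?_) ?_
    · simpa using hnext
    · simpa using h.size
    · simpa using h.blocks hnext
    · simpa using h.stack.push hnext (by simpa using he') hlt hkeep
    · exact h.out
    · simp only [ne_eq, Fin.reduceEq, not_false_eq_true, Function.update_self,
        Function.update_of_ne]
      rintro t τ ⟨ht, hτ, htop', hcount', hpending⟩
      exact ⟨by omega, hτ, by omega, hcount', hpending⟩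
  · refine WP.mono (wp_next_passInv (O := O) (out₀ := out₀) hs ?_ ?_ ?_ (fun e' he' => ?_) ?_) ?_
    · simpa using hnext
    · simpa using h.size
    · simpa using h.blocks hnext
    · simpa using h.stack.skip hnext (by simpa using he') hge
    · exact h.out
    · simp only [ne_eq, Fin.reduceEq, not_false_eq_true, Function.update_self,
        Function.update_of_ne]
      rintro t τ ⟨ht, hτ, htop', hcount', hpending⟩
      exact ⟨by omega, hτ, by omega, hcount', hpending⟩

theorem wp_pushBatchStep (hs : Sizes n S w) (h : PassInv P d S out₀ O σ)
    (hnext : σ.reg rNext < n) (hcount : σ.reg rCount < S) (htop : σ.reg rTop ≤ S) :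
    WP P (S + 1) w (pushBatchStep d) σ fun t τ => PassInv P d S out₀ O τ ∧
      (t ≤ 75 ∧ τ.reg rTop + 1 = σ.reg rTop ∧ τ.reg rCount = σ.reg rCount ∧
          τ.reg rNext = σ.reg rNext ∨
        t ≤ 400 * (S + 1) + 120 ∧ τ.reg rTop ≤ σ.reg rTop + 1 ∧
          τ.reg rCount = σ.reg rCount + 1 ∧
          pendingCount (sortKey P d) n (σ.reg rNext) =
            pendingCount (sortKey P d) n (τ.reg rNext) + 1) := by
  have hw := hs.lt_word
  have hSn := hs.size_le
  simp only [pushBatchStep, wp_seq]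
  refine (wp_loadTop h.stack.pos (by omega)).mono fun t₁ τ₁ ⟨ht₁, hagree, hupper, hbelow⟩ => ?_
  have hτ₁ := h.of_agreeOff hagree (by decide)
  rw [← hagree.arr, ← hagree.reg rTop (by decide)] at hupper hbelow
  rw [← hagree.reg rTop (by decide)] at htop ⊢
  rw [← hagree.reg rCount (by decide)] at hcount ⊢
  rw [← hagree.reg rNext (by decide)] at hnext ⊢
  simp only [wp_ite, pop, wp_assign, Test.Holds, holds_badTest, Test.cost, cost_badTest,
    WExp.eval, WExp.cost, hupper, hbelow]
  refine ⟨fun ⟨hlt, hbad⟩ => ⟨by omega, hτ₁.pop hlt hnext hbad, Or.inl ?_⟩, fun hgood => ?_⟩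
  · simp only [ne_eq, Fin.reduceEq, not_false_eq_true, Function.update_self,
      Function.update_of_ne, and_true]
    omega
  · refine (wp_advance hs hτ₁ hnext hcount htop hupper
      fun hlt => not_not.1 fun hbad => hgood ⟨hlt, hbad⟩).mono
      fun t₂ τ₂ ⟨_, hτ₂, hrest⟩ => ⟨hτ₂, Or.inr ⟨by omega, hrest⟩⟩

theorem wp_pushBatch (hs : Sizes n S w) (h : PassInv P d S out₀ O σ) (htop : σ.reg rTop = 1) :
    WP P (S + 1) w (pushBatch d) σ fun t τ => t ≤ 600 * ((S + 1) * (S + 1)) ∧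
      PassInv P d S out₀ O τ ∧ τ.reg rTop ≤ S + 1 ∧
      (n ≤ τ.reg rNext ∨ pendingCount (sortKey P d) n (τ.reg rNext) + S =
        pendingCount (sortKey P d) n (σ.reg rNext)) := by
  have hw := hs.lt_word
  have hinit := h.of_agreeOff ((AgreeOff.refl {rCount} σ).assign (r := rCount) (by simp) 0)
    (by decide)
  simp only [pushBatch, wp_seq, wp_assign, WExp.eval, WExp.cost]
  refine ⟨by omega, ?_⟩
  refine (WP.loop (fun τ => PassInv P d S out₀ O τ ∧ τ.reg rTop ≤ τ.reg rCount + 1 ∧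
      τ.reg rCount ≤ S ∧ pendingCount (sortKey P d) n (τ.reg rNext) + τ.reg rCount =
        pendingCount (sortKey P d) n (σ.reg rNext))
    (fun τ => (S - τ.reg rCount) * (590 * (S + 1)) + 90 * τ.reg rTop) ?_
    ⟨hinit, by simp [htop], by simp, by simp⟩).mono ?_
  · rintro τ ⟨hτ, hheight, -, hpending⟩ hc
    simp only [Test.Holds, WExp.eval, hτ.size] at hc
    have hpay := sub_mul_eq_sub_succ_mul_add hc.2 (590 * (S + 1))
    simp only [Test.cost, WExp.cost]
    refine (wp_pushBatchStep hs hτ hc.1 hc.2 (by omega)).mono ?_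
    rintro t τ' ⟨hτ', ⟨ht, htop', hcount, hnext⟩ | ⟨ht, htop', hcount, hpending'⟩⟩
    · rw [hcount, hnext]
      exact ⟨⟨hτ', by omega, by omega, by omega⟩, by omega⟩
    · rw [hcount]
      exact ⟨⟨hτ', by omega, by omega, by omega⟩, by omega⟩
  · rintro t τ ⟨⟨hτ, hheight, hcount, hpending⟩, hc, hμ⟩
    simp only [Test.Holds, WExp.eval, hτ.size] at hc
    simp only [Test.cost, WExp.cost, ne_eq, Fin.reduceEq, not_false_eq_true,
      Function.update_self, Function.update_of_ne, htop, Nat.sub_zero] at hμ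
    exact ⟨by nlinarith [hs.size_pos], hτ, by omega, by omega⟩

theorem wp_filterBatchStep (hs : Sizes n S w) (h : PassInv P d S out₀ O σ)
    (htop : σ.reg rTop ≤ S + 1) (hpos : σ.reg rPos < n)
    (hkept : TopKept P d (σ.reg rNext) (σ.reg rPos)
      (stackPts P (σ.arr aStack) (σ.reg rTop) ++ O)) :
    WP P (S + 1) w (filterBatchStep d) σ fun t τ => t ≤ 145 ∧ PassInv P d S out₀ O τ ∧
      TopKept P d (τ.reg rNext) (τ.reg rPos) (stackPts P (τ.arr aStack) (τ.reg rTop) ++ O) ∧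
      τ.reg rTop ≤ σ.reg rTop ∧ τ.reg rPos ≤ n ∧ τ.reg rNext = σ.reg rNext ∧
      n - τ.reg rPos + τ.reg rTop + 1 = n - σ.reg rPos + σ.reg rTop := by
  have hSn := hs.size_le
  have hw := hs.lt_word
  simp only [filterBatchStep, wp_seq]
  refine (wp_loadTop h.stack.pos htop).mono fun t₁ τ₁ ⟨ht₁, hagree, hupper, hbelow⟩ => ?_
  have hτ₁ := h.of_agreeOff hagree (by decide)
  have htop_pos := hτ₁.stack.pos
  rw [← hagree.arr, ← hagree.reg rTop (by decide)] at hupper hbelow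
  rw [← hagree.arr, ← hagree.reg rNext (by decide), ← hagree.reg rPos (by decide),
    ← hagree.reg rTop (by decide)] at hkept
  rw [← hagree.reg rPos (by decide)] at hpos ⊢
  rw [← hagree.reg rTop (by decide)] at htop ⊢
  rw [← hagree.reg rNext (by decide)]
  simp only [wp_ite, pop, wp_assign, Test.Holds, holds_badTest, holds_keyTest, Test.cost,
    cost_badTest, cost_keyTest, WExp.eval, WExp.cost, hupper, hbelow, ne_eq, Fin.reduceEq,
    not_false_eq_true, Function.update_self, Function.update_of_ne, true_and]
  refine ⟨fun ⟨hlt, _, hbad⟩ => ⟨by omega, by omega, hτ₁.pop hlt hpos hbad,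
      hτ₁.stack.topKept_pop hlt hkept, by omega, by omega, by omega⟩,
    fun hgood => ⟨by omega, by omega, ?_, ?_, le_rfl, by omega, by omega⟩⟩
  · exact hτ₁.of_agreeOff ((AgreeOff.refl {rPos} τ₁).assign (by simp) _) (by decide)
  · exact hτ₁.stack.topKept_succ hkept fun hlt hle =>
      not_not.1 fun hbad => hgood ⟨hlt, hle.not_gt, hbad⟩

theorem wp_filterBatch (hs : Sizes n S w) (h : PassInv P d S out₀ O σ)
    (htop : σ.reg rTop ≤ S + 1) :
    WP P (S + 1) w (filterBatch d) σ fun t τ => t ≤ 170 * ((S + 1) * (S + 1)) ∧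
      PassInv P d S out₀ O τ ∧ τ.reg rTop ≤ S + 1 ∧
      TopKept P d (τ.reg rNext) n (stackPts P (τ.arr aStack) (τ.reg rTop) ++ O) ∧
      τ.reg rNext = σ.reg rNext := by
  have hw := hs.lt_word
  have hinit := h.of_agreeOff ((AgreeOff.refl {rPos} σ).assign (r := rPos) (by simp) 0) (by decide)
  simp only [filterBatch, wp_seq, wp_assign, WExp.eval, WExp.cost]
  refine ⟨by omega, ?_⟩
  refine (WP.loop (fun τ => PassInv P d S out₀ O τ ∧ τ.reg rTop ≤ S + 1 ∧ τ.reg rPos ≤ n ∧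
      TopKept P d (τ.reg rNext) (τ.reg rPos) (stackPts P (τ.arr aStack) (τ.reg rTop) ++ O) ∧
      τ.reg rNext = σ.reg rNext)
    (fun τ => 150 * (n - τ.reg rPos + τ.reg rTop)) ?_ ⟨hinit, htop, by simp, ?_, by simp⟩).mono ?_
  · rintro τ ⟨hτ, htop', -, hkept, hnext⟩ hc
    simp only [Test.cost, WExp.cost]
    refine (wp_filterBatchStep hs hτ htop' hc hkept).mono
      fun t τ' ⟨_, hτ', hkept', hheight, hpos, hnext', _⟩ => ?_
    exact ⟨⟨hτ', hheight.trans htop', hpos, hkept', hnext'.trans hnext⟩, by omega⟩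
  · intro u a l _ i _ hi
    simp at hi
  · rintro t τ ⟨⟨hτ, htop', hpos, hkept, hnext⟩, hc, hμ⟩
    simp only [Test.Holds, WExp.eval] at hc
    simp only [Test.cost, WExp.cost, ne_eq, Fin.reduceEq, not_false_eq_true,
      Function.update_self, Function.update_of_ne, Nat.sub_zero] at hμ
    rw [show τ.reg rPos = n by omega] at hkept
    have hle := hs.le_sq
    exact ⟨by nlinarith, hτ, htop', hkept, hnext⟩

theorem wp_reportStack (hpos : 0 < σ.reg rTop) (htop : σ.reg rTop ≤ s) (htop' : σ.reg rTop < w) :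
    WP P s w reportStack σ fun t τ => t ≤ 30 * (σ.reg rTop + 1) ∧
      τ.reg rPos = σ.reg rTop - 1 ∧ τ.arr = σ.arr ∧
      τ.out = σ.out ++ (stackPts P (σ.arr aStack) (σ.reg rTop - 1)).reverse ∧
      ∀ r ∉ ({rPos, rBelow} : Finset (Fin 10)), τ.reg r = σ.reg r := by
  simp only [reportStack, wp_seq, wp_assign, WExp.eval, WExp.cost]
  refine ⟨by omega, ?_⟩
  refine (WP.loop (fun τ => τ.reg rPos + 1 ≤ σ.reg rTop ∧ τ.arr = σ.arr ∧
      τ.out = σ.out ++ (stackPts P (σ.arr aStack) (τ.reg rPos)).reverse ∧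
      ∀ r ∉ ({rPos, rBelow} : Finset (Fin 10)), τ.reg r = σ.reg r)
    (fun τ => 30 * (σ.reg rTop - τ.reg rPos)) ?_ ?_).mono ?_
  · rintro τ ⟨-, harr, hout, hreg⟩ hc
    simp only [Test.Holds, WExp.eval, hreg rTop (by decide)] at hc
    simp only [wp_seq, wp_assign, wp_load, wp_report, WExp.eval, WExp.cost, Test.cost, ne_eq,
      Fin.reduceEq, not_false_eq_true, Function.update_self, Function.update_of_ne, harr, hout,
      true_and]
    refine ⟨by omega, by omega, ⟨by omega, by simp [stackPts], fun r hr => ?_⟩, by omega⟩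
    have hne : r ≠ rPos ∧ r ≠ rBelow := by simpa using hr
    rw [Function.update_of_ne hne.1, Function.update_of_ne hne.2, hreg r hr]
  · refine ⟨by simpa [Nat.succ_le_iff] using hpos, rfl, by simp [stackPts], ?_⟩
    exact ((AgreeOff.refl {rPos, rBelow} σ).assign (r := rPos) (by simp) 0).reg
  · rintro t τ ⟨⟨hle, harr, hout, hreg⟩, hc, hμ⟩
    simp only [Test.Holds, WExp.eval, hreg rTop (by decide)] at hc
    simp only [Test.cost, WExp.cost, Function.update_self] at hμ
    have hlast : τ.reg rPos = σ.reg rTop - 1 := by omega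
    exact ⟨by omega, hlast, harr, hlast ▸ hout, hreg⟩

theorem wp_flushBatch (hs : Sizes n S w) (h : PassInv P d S out₀ O σ)
    (htop : σ.reg rTop ≤ S + 1)
    (hkept : TopKept P d (σ.reg rNext) n (stackPts P (σ.arr aStack) (σ.reg rTop) ++ O)) :
    WP P (S + 1) w flushBatch σ fun t τ => t ≤ 50 * ((S + 1) * (S + 1)) ∧
      (∃ O', PassInv P d S out₀ O' τ) ∧ τ.reg rTop = 1 ∧ τ.reg rNext = σ.reg rNext := by
  have hw := hs.lt_word
  have hSn := hs.size_le
  have hpos := h.stack.pos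
  have hlt := h.stack.lt (σ.reg rTop - 1) (by omega)
  simp only [flushBatch, wp_seq]
  refine (wp_reportStack hpos htop (by omega)).mono fun t τ ⟨_, hlast, harr, hout, hreg⟩ => ?_
  have hnext := hreg rNext (by decide)
  simp only [wp_load, wp_store, wp_assign, WExp.eval, WExp.cost, ne_eq, Fin.reduceEq,
    not_false_eq_true, Function.update_self, Function.update_of_ne, harr, hlast, hnext, and_true]
  refine ⟨by omega, by omega, by omega, by omega, by nlinarith [hs.size_pos],
    stackPts P (σ.arr aStack) (σ.reg rTop - 1) ++ O, ?_, ?_, ?_, ?_⟩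
  · simpa [hreg rSize (by decide)] using h.size
  · simpa [hnext] using h.blocks
  · simpa [hnext] using h.stack.flush hkept
  · rw [hout, h.out, List.reverse_append, List.append_assoc]

theorem wp_startPass (hs : Sizes n S w) :
    WP P (S + 1) w (startPass d) σ fun t τ => t ≤ 1150 * ((S + 1) * (S + 1)) ∧
      PassInv P d S σ.out [] τ ∧ τ.reg rTop = 1 := by
  have hw := hs.lt_word
  simp only [startPass, wp_seq]
  refine (wp_start hs).mono fun t₁ τ₁ ⟨_, hsize, hend, hfirsts, hout⟩ => ?_
  refine (wp_next hs hsize (by rwa [hend])).mono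
    fun t₂ τ₂ ⟨_, hfirst, hblocks, _, hout₂, hreg₂⟩ => ?_
  rw [hend] at hfirst
  have hlt := isFirst_lt (isSortKey_sortKey P d) hs.pos hfirst
  simp only [wp_store, wp_assign, WExp.eval, WExp.cost]
  refine ⟨by omega, by omega, by omega, ?_⟩
  refine (wp_next_passInv hs (by simpa using hlt) (by simpa [hreg₂ rSize (by decide)])
    (by simpa using hblocks hlt) (O := []) (out₀ := σ.out) (fun e' he' => ?_)
    (by simp [hout₂, hout])).mono fun t₃ τ₃ ⟨_, hτ₃, htop, _⟩ => ⟨by nlinarith, hτ₃, htop⟩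
  simpa using stackInv_singleton hlt hfirst (by simpa using he')

theorem wp_passBatch (hs : Sizes n S w) (h : PassInv P d S out₀ O σ) (htop : σ.reg rTop = 1) :
    WP P (S + 1) w (passBatch d) σ fun t τ => t ≤ 820 * ((S + 1) * (S + 1)) ∧
      (∃ O', PassInv P d S out₀ O' τ) ∧ τ.reg rTop = 1 ∧
      (n ≤ τ.reg rNext ∨ pendingCount (sortKey P d) n (τ.reg rNext) + S =
        pendingCount (sortKey P d) n (σ.reg rNext)) := by
  simp only [passBatch, wp_seq]
  refine (wp_pushBatch hs h htop).mono fun t₁ τ₁ ⟨_, hτ₁, htop₁, hprogress⟩ => ?_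
  refine (wp_filterBatch hs hτ₁ htop₁).mono fun t₂ τ₂ ⟨_, hτ₂, htop₂, hkept, hnext₂⟩ => ?_
  refine (wp_flushBatch hs hτ₂ htop₂ hkept).mono fun t₃ τ₃ ⟨_, hτ₃, htop₃, hnext₃⟩ => ?_
  exact ⟨by omega, hτ₃, htop₃, by rwa [hnext₃, hnext₂]⟩

theorem wp_pass (hs : Sizes n S w) :
    WP P (S + 1) w (pass d) σ fun t τ => t ≤ 20000 * (S * S * S) ∧
      ∃ L, IsHullChain d (Set.range P) L ∧ τ.out = σ.out ++ L.dropLast := by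
  have hS := hs.size_pos
  simp only [pass, wp_seq]
  refine (wp_startPass hs).mono fun t₁ τ₁ ⟨_, hτ₁, htop₁⟩ => ?_
  refine (WP.loop (fun τ => (∃ O, PassInv P d S σ.out O τ) ∧ τ.reg rTop = 1)
    (fun τ => if τ.reg rNext < n then
      (pendingCount (sortKey P d) n (τ.reg rNext) + S) * (1800 * (S + 1)) else 0)
    ?_ ⟨⟨[], hτ₁⟩, htop₁⟩).mono ?_
  · rintro τ ⟨⟨O, hτ⟩, htop⟩ hc
    refine (wp_passBatch hs hτ htop).mono fun t τ' ⟨_, hτ', htop', hprogress⟩ => ⟨⟨hτ', htop'⟩, ?_⟩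
    simp only [Test.Holds, WExp.eval] at hc
    simp only [Test.cost, WExp.cost, if_pos hc]
    have hpay : 3 + t ≤ S * (1800 * (S + 1)) := by nlinarith
    generalize 1800 * (S + 1) = K at hpay ⊢
    split_ifs with hlt
    · rw [← hprogress.resolve_left hlt.not_ge, add_mul (_ + S)]
      omega
    · rw [add_mul]
      omega
  · rintro t τ ⟨⟨⟨O, hτ⟩, htop⟩, hc, hμ⟩
    simp only [Test.Holds, WExp.eval, not_lt] at hc
    have hcount : pendingCount (sortKey P d) n (τ₁.reg rNext) ≤ S * S :=
      pendingCount_le.trans hs.le_sq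
    have hμ₁ : t ≤ (S * S + S) * (1800 * (S + 1)) + 3 := by
      simp only [Test.cost, WExp.cost] at hμ
      split_ifs at hμ
      all_goals nlinarith
    have hstack := hτ.stack
    rw [htop] at hstack
    refine ⟨?_, _, hstack.isHullChain hc, ?_⟩
    · nlinarith
    · rw [List.reverse_cons, List.dropLast_concat, hτ.out]

theorem wp_reportIfConstant (hs : Sizes n S w) :
    WP P (S + 1) w reportIfConstant σ fun t τ => t ≤ 200 * (S * S * S) ∧
      (((Set.range P).Nontrivial ∧ τ.out = σ.out) ∨
        ∃ p, Set.range P = {p} ∧ τ.out = σ.out ++ [p]) := by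
  have hw := hs.lt_word
  have hcube : n ≤ S * S * S := hs.le_sq.trans (Nat.le_mul_of_pos_right _ hs.size_pos)
  have hpos := hs.pos
  simp only [reportIfConstant, wp_seq, wp_assign, WExp.eval, WExp.cost]
  refine ⟨by omega, ?_⟩
  refine (WP.loop (fun τ => τ.reg rPos ≤ n ∧ τ.out = σ.out ∧
      ∀ i < τ.reg rPos, readPoint P i = readPoint P 0)
    (fun τ => 80 * (n - τ.reg rPos)) ?_ (by simp)).mono ?_
  · rintro τ ⟨-, hout, hconst⟩ hc
    simp only [Test.Holds, WExp.eval, holds_dirTest, not_or, not_lt] at hc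
    simp only [wp_assign, WExp.eval, WExp.cost, Test.cost, cost_dirTest, Function.update_self,
      hout, true_and]
    refine ⟨by omega, ⟨by omega, fun i hi => ?_⟩, by omega⟩
    rcases Nat.lt_succ_iff_lt_or_eq.1 hi with hi | rfl
    · exact hconst i hi
    · exact lexKey_injective 1 (hc.2.1.antisymm hc.2.2)
  · rintro t τ ⟨⟨hle, hout, hconst⟩, hc, hμ⟩
    simp only [Test.Holds, WExp.eval, holds_dirTest] at hc
    simp only [WExp.cost, Test.cost, cost_dirTest, Function.update_self] at hμ
    simp only [wp_ite, wp_skip, wp_report, Test.Holds, Test.cost, WExp.eval, WExp.cost, hout]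
    refine ⟨fun hlt => ⟨by omega, Or.inl ⟨?_, trivial⟩⟩,
      fun hge => ⟨by omega, Or.inr ⟨readPoint P 0, Set.eq_singleton_iff_unique_mem.2
        ⟨readPoint_mem_range hpos, ?_⟩, rfl⟩⟩⟩
    · refine ⟨_, readPoint_mem_range hpos, _, readPoint_mem_range hlt, fun heq => hc ⟨hlt, ?_⟩⟩
      simp [heq]
    · rintro _ ⟨i, rfl⟩
      rw [show P i = readPoint P i from (readPoint_of_lt i.2).symm]
      exact hconst i (by omega)

theorem wp_hullProg (hs : Sizes n S w) :
    WP P (S + 1) w hullProg (State.init 10 2) fun t τ =>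
      IsConvexHullList (Set.range P) τ.out ∧ t ≤ 50000 * (S * S * S) := by
  simp only [hullProg, wp_seq]
  refine (wp_reportIfConstant hs).mono fun t₁ τ₁ ⟨_, hconst⟩ => ?_
  refine (wp_pass hs).mono fun t₂ τ₂ ⟨_, U, hU, hout₂⟩ => ?_
  refine (wp_pass hs).mono fun t₃ τ₃ ⟨_, D, hD, hout₃⟩ => ⟨?_, by omega⟩
  rw [hout₃, hout₂]
  rcases hconst with ⟨hnt, hout⟩ | ⟨p, hp, hout⟩
  · rw [hout]
    exact isConvexHullList_of_chains (Set.finite_range P) hnt hU hD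
  · rw [hp] at hU hD ⊢
    rw [hout, hU.dropLast_eq_nil, hD.dropLast_eq_nil]
    exact isConvexHullList_singleton p

end Hull

section Bounds

variable {n S w : ℕ}

theorem exists_sizes (hn : 0 < n) : ∃ S, Sizes n S ((n + 1) ^ 2) := by
  have hex : ∃ S, n ≤ S * S := ⟨n, Nat.le_mul_self n⟩
  have hle : Nat.find hex ≤ n := Nat.find_min' hex (Nat.le_mul_self n)
  exact ⟨Nat.find hex, hn, Nat.find_spec hex, fun k hk => not_le.1 (Nat.find_min hex hk),
    by nlinarith, by nlinarith⟩

theorem Sizes.one_le_sqrt (hs : Sizes n S w) : 1 ≤ √(n : ℝ) :=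
  Real.one_le_sqrt.2 (Nat.one_le_cast.2 hs.pos)

theorem Sizes.size_le_two_mul_sqrt (hs : Sizes n S w) : (S : ℝ) ≤ 2 * √n := by
  have hpred : (S : ℝ) - 1 ≤ √n := by
    rw [← Nat.cast_pred hs.size_pos]
    refine Real.le_sqrt_of_sq_le ?_
    rw [sq]
    exact_mod_cast (hs.sq_lt (S - 1) (Nat.sub_lt hs.size_pos one_pos)).le
  linarith [hs.one_le_sqrt]

theorem Sizes.size_cube_le (hs : Sizes n S w) :
    ((S * S * S : ℕ) : ℝ) ≤ 8 * (n : ℝ) ^ (3 / 2 : ℝ) :=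
  calc ((S * S * S : ℕ) : ℝ) = (S : ℝ) ^ 3 := by push_cast; ring
    _ ≤ (2 * √n) ^ 3 := pow_le_pow_left₀ S.cast_nonneg hs.size_le_two_mul_sqrt 3
    _ = 8 * √n ^ 3 := by ring
    _ = 8 * (n : ℝ) ^ (3 / 2 : ℝ) := by
      rw [Real.sqrt_eq_rpow, ← Real.rpow_natCast, ← Real.rpow_mul n.cast_nonneg]
      norm_num

end Bounds

end PointRAM

theorem theorem1_general :
    ∃ (k m : ℕ) (prog : PointRAM.Prog k m) (c : ℕ) (C : ℝ),
      ∀ (n : ℕ), 0 < n → ∀ P : Fin n → ℝ × ℝ,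
        ∃ (s t : ℕ) (τ : PointRAM.State k m),
          PointRAM.Exec P s ((n + 1) ^ c) prog (PointRAM.State.init k m) t τ ∧
          IsConvexHullList (Set.range P) τ.out ∧
          ((k + m * s : ℕ) : ℝ) ≤ C * (n : ℝ) ^ (1 / 2 : ℝ) ∧
          (t : ℝ) ≤ C * (n : ℝ) ^ (3 / 2 : ℝ) := by
  refine ⟨10, 2, PointRAM.hullProg, 2, 400000, fun n hn P => ?_⟩
  obtain ⟨S, hs⟩ := PointRAM.exists_sizes hn
  obtain ⟨t, τ, hexec, hhull, ht⟩ := PointRAM.wp_hullProg (P := P) hs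
  refine ⟨S + 1, t, τ, hexec, hhull, ?_, ?_⟩
  · rw [← Real.sqrt_eq_rpow]
    push_cast
    linarith [hs.one_le_sqrt, hs.size_le_two_mul_sqrt]
  · have htime : (t : ℝ) ≤ 50000 * ((S * S * S : ℕ) : ℝ) := by exact_mod_cast ht
    linarith [hs.size_cube_le]

theorem theorem1 :
    ∃ (k m : ℕ) (prog : PointRAM.Prog k m) (c : ℕ) (C : ℝ),
      ∀ (n : ℕ), 0 < n → ∀ P : Fin n → ℝ × ℝ,
        ∃ (s t : ℕ) (τ : PointRAM.State k m),
          PointRAM.Exec P s ((n + 1) ^ c) prog (PointRAM.State.init k m) t τ ∧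
          IsConvexHullList (Set.range P) τ.out ∧
          ((k + m * s : ℕ) : ℝ) ≤ C * (n : ℝ) ^ (1 / 2 : ℝ) ∧
          ∀ ε : ℝ, √(Real.log (Real.log n) / Real.log n) < ε → ε < 1 →
            (t : ℝ) ≤ C * (n : ℝ) ^ (3 / 2 + ε) := by
  obtain ⟨k, m, prog, c, C, h⟩ := theorem1_general
  refine ⟨k, m, prog, c, C, fun n hn P => ?_⟩
  obtain ⟨s, t, τ, hexec, hhull, hspace, htime⟩ := h n hn P
  refine ⟨s, t, τ, hexec, hhull, hspace, fun ε hε _ => htime.trans ?_⟩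
  have hC : 0 ≤ C := nonneg_of_mul_nonneg_left (t.cast_nonneg.trans htime) (by positivity)
  have hε₀ : 0 ≤ ε := (Real.sqrt_nonneg _).trans hε.le
  gcongr
  · exact_mod_cast hn
  · exact le_add_of_nonneg_right hε₀
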